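/- Let $\Omega=(0,\pi)\times(0,\pi)$, and let $\Gamma$ be a nonempty, relatively open subset of $\partial\Omega$ whose closure is included in one (closed) side of $\Omega$. Let $X=H^1_0(\Omega)$ with $\|z\|_X^2=\int_\Omega|\nabla z|^2\,dx$, let $Y=L^2(\Gamma)$ with respect to arc length, and let $Cz=\partial_\nu z|_\Gamma$, where $\partial_\nu$ is the outward normal derivative. For $k=(m,n)\in\mathbb N^*\times\mathbb N^*$ put $$\lambda_{k}=\lambda_{m,n}=m^2+n^2,\qquad \phi_{k}(x)=\phi_{m,n}(x)=\frac{2}{\pi\sqrt{m^2+n^2}}\,\sin(n x_1)\sin(m x_2),$$ the eigenvalues and the eigenfunctions, normalized in $X$, of the Dirichlet Laplacian $A=-\Delta$ on $\Omega$. For $\varepsilon>0$ and $\lambda\ge 0$ let $N_\varepsilon(\lambda)$ be the finite set $\{k\in\mathbb N^*\times\mathbb N^*:\ |\lambda-\lambda_k|<\varepsilon\}$. Then $C$ is weakly spectrally coercive: there are a constant $\varepsilon>0$ and a continuous non-increasing function $\psi:[0,\infty)\to(0,\infty)$ such that, for every $\lambda\ge0$ and every $z=\sum_{k\in N_\varepsilon(\lambda)}z_k\phi_k$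 with $z_k\in\mathbb C$, $$\|Cz\|_Y^2\ \ge\ \psi(\lambda)\,\|z\|_X^2 .$$ More precisely, there is a constant $\delta_\Gamma>0$ depending only on $\Gamma$ such that, for all $m,n\in\mathbb N^*$ and all $z=\sum_{k\in N_{1/2}(\lambda_{m,n})}z_k\phi_k$ with $z_k\in\mathbb C$ (that is, all $z$ in the eigenspace of $\lambda_{m,n}$), $$\|Cz\|_Y^2\ \ge\ \frac{\delta_\Gamma}{\lambda_{m,n}}\,\|z\|_X^2 .$$ -/

import Mathlib

open MeasureTheory

noncomputable section

namespace SquareObservability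

/-- The plane with its Euclidean norm. -/
abbrev Plane : Type := EuclideanSpace ℝ (Fin 2)

/-- The open square `Ω = (0, π) × (0, π)`. -/
def square : Set Plane := {x | ∀ i, x i ∈ Set.Ioo 0 Real.pi}

/-- The closed side of the square on which the coordinate `i` is equal to `c`
(this is one of the four sides when `c = 0` or `c = π`). -/
def side (i : Fin 2) (c : ℝ) : Set Plane := {x | x ∈ frontier square ∧ x i = c}

/-- `Γ` is a nonempty, relatively open subset of the boundary of the square,
and its closure is included in one of the four sides. -/
structure IsOneSidedObservationSet (Γ : Set Plane) : Prop where
  relatively_open : ∃ U : Set Plane, IsOpen U ∧ Γ = U ∩ frontier square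
  nonempty : Γ.Nonempty
  one_side : ∃ i : Fin 2, ∃ c : ℝ, (c = 0 ∨ c = Real.pi) ∧ closure Γ ⊆ side i c

/-- The outward unit normal vector on the boundary of the square. It is meant at boundary points
other than the four corners, where no normal exists (an observation set as above contains no
corner). -/
def outwardNormal (x : Plane) : Plane :=
  if x 0 = 0 then -EuclideanSpace.single 0 1
  else if x 0 = Real.pi then EuclideanSpace.single 0 1
  else if x 1 = 0 then -EuclideanSpace.single 1 1
  else EuclideanSpace.single 1 1

/-- The normal derivative `∂_ν u` of a function on the closed square. -/
def normalDerivative (u : Plane → ℂ) (x : Plane) : ℂ :=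
  fderivWithin ℝ u (closure square) x (outwardNormal x)

/-- `‖u‖_X² = ∫_Ω |∇u|² dx`, the squared norm of `X = H¹₀(Ω)`. -/
def normSqX (u : Plane → ℂ) : ℝ :=
  ∫ x in square, ∑ i : Fin 2, ‖fderiv ℝ u x (EuclideanSpace.single i 1)‖ ^ 2

/-- `‖C u‖_Y² = ∫_Γ |∂_ν u|² ds`, the squared norm in `Y = L²(Γ)` of the boundary observation
`C u = ∂_ν u` restricted to `Γ`; `ds` is arc length. -/
def normSqObservation (Γ : Set Plane) (u : Plane → ℂ) : ℝ :=
  ∫ x in Γ, ‖normalDerivative u x‖ ^ 2 ∂(Measure.hausdorffMeasure 1)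

/-- The eigenvalues `λ_{m,n} = m² + n²`, `m, n ≥ 1`, of the Dirichlet Laplacian `A = -Δ`. -/
def eigenvalue (k : ℕ+ × ℕ+) : ℝ := ((k.1 : ℕ) : ℝ) ^ 2 + ((k.2 : ℕ) : ℝ) ^ 2

/-- The eigenfunctions
`φ_{m,n}(x) = 2 / (π √(m² + n²)) · sin (n x₁) sin (m x₂)`, normalized in `H¹₀(Ω)`. -/
def eigenfunction (k : ℕ+ × ℕ+) (x : Plane) : ℂ :=
  ((2 / (Real.pi * Real.sqrt (eigenvalue k))
    * Real.sin (((k.2 : ℕ) : ℝ) * x 0) * Real.sin (((k.1 : ℕ) : ℝ) * x 1) : ℝ) : ℂ)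

/-- `N_ε(μ)`: the indices of the eigenvalues at distance less than `ε` from `μ`. -/
def indexSet (ε μ : ℝ) : Set (ℕ+ × ℕ+) := {k | |μ - eigenvalue k| < ε}

theorem indexSet_finite (ε μ : ℝ) : (indexSet ε μ).Finite := by
  obtain ⟨M, hM⟩ := exists_nat_gt (μ + ε)
  have hfin : (Set.Iic (M.succPNat) ×ˢ Set.Iic (M.succPNat) : Set (ℕ+ × ℕ+)).Finite :=
    (Set.finite_Iic _).prod (Set.finite_Iic _)
  refine hfin.subset ?_
  rintro ⟨p, q⟩ hk
  have hk' : |μ - (((p : ℕ) : ℝ) ^ 2 + ((q : ℕ) : ℝ) ^ 2)| < ε := hk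
  have h1 := (abs_lt.mp hk').1
  have hp : (1 : ℝ) ≤ ((p : ℕ) : ℝ) := by exact_mod_cast p.pos
  have hq : (1 : ℝ) ≤ ((q : ℕ) : ℝ) := by exact_mod_cast q.pos
  have hpM : ((p : ℕ) : ℝ) < M := by nlinarith
  have hqM : ((q : ℕ) : ℝ) < M := by nlinarith
  have hpM' : (p : ℕ) < M := by exact_mod_cast hpM
  have hqM' : (q : ℕ) < M := by exact_mod_cast hqM
  constructor
  · change (p : ℕ) ≤ (M.succPNat : ℕ)
    rw [Nat.succPNat_coe]; omega
  · change (q : ℕ) ≤ (M.succPNat : ℕ)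
    rw [Nat.succPNat_coe]; omega

/-- The vector `z = ∑_{k ∈ N_ε(μ)} z_k φ_k` with complex coefficients `z_k`. -/
def spectralSum (ε μ : ℝ) (a : ℕ+ × ℕ+ → ℂ) (x : Plane) : ℂ :=
  ∑ k ∈ (indexSet_finite ε μ).toFinset, a k * eigenfunction k x

/-- The class of continuous, decreasing (in the wide sense), strictly positive functions
on `[0, ∞)`. -/
def IsCoercivityProfile (ψ : ℝ → ℝ) : Prop :=
  ContinuousOn ψ (Set.Ici 0) ∧ AntitoneOn ψ (Set.Ici 0) ∧ ∀ t, 0 ≤ t → 0 < ψ t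

/-- Weak spectral coercivity of the operator `C u = ∂_ν u` on `Γ`. -/
def IsWeaklySpectrallyCoercive (Γ : Set Plane) : Prop :=
  ∃ ε : ℝ, 0 < ε ∧ ∃ ψ : ℝ → ℝ, IsCoercivityProfile ψ ∧
    ∀ μ : ℝ, 0 ≤ μ → ∀ a : ℕ+ × ℕ+ → ℂ,
      ψ μ * normSqX (spectralSum ε μ a) ≤ normSqObservation Γ (spectralSum ε μ a)

end SquareObservability

end

/-!
On a side of the square the normal derivative of an eigenfunction combination with eigenvalue
`N = m² + n²` is, up to factors of modulus at least `2 / (π √N)`, a sum `∑ c_m sin (m y)` whose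
frequencies `m` are distinct abscissae of lattice points of the circle `x² + y² = N`. All that is
needed is the inequality `∑ |c_m|² ≤ K ∫_I |∑ c_m sin (m y)|² dy` on a given interval `I`, with `K`
independent of `N`; the power `1 / N` comes from the normalization of the eigenfunctions in `H¹₀`.

*Arithmetic.* The abscissae of the lattice points of a circle have density zero, uniformly in the
circle: modulo a prime `p ≡ 3 mod 4` they avoid almost half of the residues
(`two_mul_card_circle_projection_le`), and by the Chinese remainder theorem a window whose length is
a product of `k` such primes (large enough) contains a proportion at most `(13 / 14) ^ k` of
abscissae (`exists_window_card_lattice_abscissae_le`).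

*Analysis.* Integer frequencies of density zero can be observed on arbitrarily short intervals
(Beurling, Kahane). The constant has to depend on the density bound only, so the argument is made
quantitative by duality. For each frequency `s` a function supported in `I` is built whose Fourier
transform is `1` at `s`, vanishes at the other frequencies and decays summably away from `s`
(`exists_symbol_of_window`). It is a convolution, so that supports add up and Fourier transforms
multiply: the frequencies are split by their rank modulo `r` into `r` sets with gaps `≥ L`, where
`r / L` is small; each of them is treated on an interval of length `O(1 / L)` by inverting a
diagonally dominant Gram matrix (`exists_symbol_of_gap`); the at most `2 r` frequencies at distance
less than `L` of `s` are killed by differences of translates (`exists_symbol_killing_near`); and a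
triangle function provides the decay. Parseval's identity and Young's inequality then give the lower
bound (`sum_sq_le_of_biorthogonal`, `exists_sum_sq_le_integral_sin`).

Finally the eigenvalues are integers, so that the indices in `N_{1/2}(μ)` share one eigenvalue, which
is at most `μ + 1`: the bound on the eigenspaces gives weak coercivity with `ψ(μ) = δ / (μ + 1)`.
-/

namespace SquareObservability

/-! ### Lattice points of circles in short windows -/

/-- For `p ≡ 3 mod 4` a line of given slope through a point of the circle `x² + y² = M` meets it in
at most one other point, so that the circle has at most `p + 2` points; the abscissae are about half
as many, since `(x, y)` and `(x, -y)` have the same one. -/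
theorem two_mul_card_circle_projection_le {p : ℕ} [Fact p.Prime] (hp : p % 4 = 3) (M : ZMod p) :
    2 * (Finset.univ.filter fun x : ZMod p => ∃ y, x ^ 2 + y ^ 2 = M).card ≤ p + 6 := by
  classical
  set A := Finset.univ.filter fun x : ZMod p => ∃ y, x ^ 2 + y ^ 2 = M with hA
  rcases A.eq_empty_or_nonempty with h0 | ⟨a, ha⟩
  · simp [h0]
  have hchoose : ∀ x : ZMod p, ∃ y, x ∈ A → x ^ 2 + y ^ 2 = M := by
    intro x
    by_cases hx : x ∈ A
    · obtain ⟨y, hy⟩ := (Finset.mem_filter.mp hx).2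
      exact ⟨y, fun _ => hy⟩
    · exact ⟨0, fun h => absurd h hx⟩
  choose y hy using hchoose
  have hnsq : ∀ t : ZMod p, 1 + t ^ 2 ≠ 0 := by
    intro t ht
    exact ZMod.mod_four_ne_three_of_sq_eq_neg_one (y := t) (by linear_combination ht) hp
  have h2 : (2 : ZMod p) ≠ 0 := by
    intro h
    have : p ∣ 2 := (ZMod.natCast_eq_zero_iff 2 p).mp (by exact_mod_cast h)
    have := Nat.le_of_dvd (by norm_num) this
    interval_cases p <;> simp_all
  set B := A.filter fun x => x ≠ a ∧ x ^ 2 ≠ M with hB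
  set R := Finset.univ.filter fun x : ZMod p => x ^ 2 = M with hR
  have hRcard : R.card ≤ 2 := by
    rcases R.eq_empty_or_nonempty with h0 | ⟨c, hc⟩
    · simp [h0]
    · refine (Finset.card_le_card (t := {c, -c}) ?_).trans Finset.card_le_two
      intro x hx
      simp only [hR, Finset.mem_filter, Finset.mem_univ, true_and] at hx hc
      rw [Finset.mem_insert, Finset.mem_singleton]
      exact sq_eq_sq_iff_eq_or_eq_neg.mp (hx.trans hc.symm)
  have hAB : A.card ≤ B.card + 3 := by
    have hsub : A ⊆ B ∪ (R ∪ {a}) := by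
      intro x hx
      by_cases h1 : x = a
      · simp [h1]
      · by_cases h2 : x ^ 2 = M
        · simp [hR, h2]
        · simp [hB, hx, h1, h2]
    calc A.card ≤ (B ∪ (R ∪ {a})).card := Finset.card_le_card hsub
      _ ≤ B.card + (R.card + 1) :=
        (Finset.card_union_le _ _).trans (Nat.add_le_add_left
          ((Finset.card_union_le _ _).trans (by simp)) _)
      _ ≤ B.card + 3 := by omega
  have hBp : B.card * 2 ≤ p := by
    have hcard : ({1, -1} : Finset (ZMod p)).card = 2 := by
      refine Finset.card_pair ?_
      intro h
      apply h2
      linear_combination h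
    have hle : (B ×ˢ ({1, -1} : Finset (ZMod p))).card ≤ (Finset.univ : Finset (ZMod p)).card := by
      -- `t` is the slope of the line through `(a, y a)` and `(x, ± y x)`
      refine Finset.card_le_card_of_injOn
        (fun q => (q.2 * y q.1 - y a) / (q.1 - a)) (fun _ _ => Finset.mem_univ _) ?_
      rintro ⟨x, e⟩ hx ⟨x', e'⟩ hx' heq
      simp only [Finset.coe_product, Set.mem_prod, Finset.mem_coe, hB, Finset.mem_filter,
        Finset.mem_insert, Finset.mem_singleton] at hx hx'
      obtain ⟨⟨hxA, hxa, hxM⟩, he⟩ := hx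
      obtain ⟨⟨hxA', hxa', hxM'⟩, he'⟩ := hx'
      have hesq : e ^ 2 = 1 := by rcases he with rfl | rfl <;> ring
      have hesq' : e' ^ 2 = 1 := by rcases he' with rfl | rfl <;> ring
      have hu : x - a ≠ 0 := sub_ne_zero.mpr hxa
      have hu' : x' - a ≠ 0 := sub_ne_zero.mpr hxa'
      simp only at heq
      set t := (e * y x - y a) / (x - a) with ht
      have h1 : e * y x = y a + t * (x - a) := by
        rw [ht]; field_simp; ring
      have h1' : e' * y x' = y a + t * (x' - a) := by
        rw [heq]; field_simp; ring
      have hc := hy a ha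
      have hcx := hy x hxA
      have hcx' := hy x' hxA'
      have key : ∀ (x e : ZMod p), x - a ≠ 0 → e ^ 2 = 1 → x ^ 2 + y x ^ 2 = M →
          e * y x = y a + t * (x - a) → (x - a) * (1 + t ^ 2) = -2 * (a + y a * t) := by
        intro x e hu he hcx h1
        refine mul_left_cancel₀ hu ?_
        have : (e * y x) ^ 2 = (y a + t * (x - a)) ^ 2 := by rw [h1]
        linear_combination hcx - hc - this + y x ^ 2 * he
      have hk := key x e hu hesq hcx h1
      have hk' := key x' e' hu' hesq' hcx' h1'
      have hxx : x = x' := by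
        have := mul_right_cancel₀ (hnsq t) (hk.trans hk'.symm)
        linear_combination this
      subst hxx
      have hyx : y x ≠ 0 := by
        intro h
        apply hxM
        rw [h] at hcx
        linear_combination hcx
      have : e = e' := mul_right_cancel₀ hyx (h1.trans h1'.symm)
      rw [this]
    rw [Finset.card_product, hcard, Finset.card_univ, ZMod.card] at hle
    exact hle
  omega

/-- The integers `0 ≤ x < q` such that `M - x ^ 2` is a square modulo `q`. -/
noncomputable def circleResidues (q : ℕ) (M : ℤ) : Finset ℤ :=
  open Classical in
  (Finset.Ico (0 : ℤ) q).filter fun x => ∃ n : ℤ, x ^ 2 + n ^ 2 ≡ M [ZMOD q]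

theorem two_mul_card_circleResidues_le {p : ℕ} (hpp : p.Prime) (hp : p % 4 = 3) (M : ℤ) :
    2 * (circleResidues p M).card ≤ p + 6 := by
  classical
  have := Fact.mk hpp
  refine le_trans (Nat.mul_le_mul_left 2 ?_) (two_mul_card_circle_projection_le hp (M : ZMod p))
  refine Finset.card_le_card_of_injOn (fun x : ℤ => (x : ZMod p)) ?_ ?_
  · intro x hx
    obtain ⟨-, n, hn⟩ := Finset.mem_filter.mp hx
    refine Finset.mem_coe.mpr (Finset.mem_filter.mpr ⟨Finset.mem_univ _, (n : ZMod p), ?_⟩)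
    have := (ZMod.intCast_eq_intCast_iff _ _ p).mpr hn
    push_cast at this
    exact this
  · intro x hx x' hx' h
    have hx := Finset.mem_Ico.mp (Finset.mem_filter.mp hx).1
    have hx' := Finset.mem_Ico.mp (Finset.mem_filter.mp hx').1
    have := (ZMod.intCast_eq_intCast_iff _ _ p).mp h
    rw [Int.ModEq, Int.emod_eq_of_lt hx.1 hx.2, Int.emod_eq_of_lt hx'.1 hx'.2] at this
    exact this

/-- Sieve bound: in a window whose length is a product of primes `p ≡ 3 mod 4`, the abscissae of
the lattice points of a circle occupy at most `(p + 6) / 2` residues for each of these primes. -/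
theorem card_lattice_abscissae_le (T : Finset ℕ) (hT : ∀ p ∈ T, p.Prime ∧ p % 4 = 3) (M z : ℤ)
    (W : Finset ℤ) (hW : ∀ x ∈ W, z ≤ x ∧ x < z + ∏ p ∈ T, p ∧ ∃ n : ℤ, x ^ 2 + n ^ 2 = M) :
    2 ^ T.card * W.card ≤ ∏ p ∈ T, (p + 6) := by
  classical
  have h1 : W.card ≤ (T.pi fun p => circleResidues p M).card := by
    refine Finset.card_le_card_of_injOn (fun x p _ => x % p) ?_ ?_
    · intro x hx
      refine Finset.mem_coe.mpr (Finset.mem_pi.mpr fun p hp => ?_)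
      have hp0 : (0 : ℤ) < p := by exact_mod_cast (hT p hp).1.pos
      obtain ⟨-, -, n, hn⟩ := hW x hx
      refine Finset.mem_filter.mpr ⟨Finset.mem_Ico.mpr
        ⟨Int.emod_nonneg _ hp0.ne', Int.emod_lt_of_pos _ hp0⟩, n, ?_⟩
      rw [← hn]
      exact ((Int.mod_modEq x p).pow 2).add_right _
    · intro x hx x' hx' h
      obtain ⟨ha, hb, -⟩ := hW x hx
      obtain ⟨ha', hb', -⟩ := hW x' hx'
      have hdvd : (∏ p ∈ T, (p : ℤ)) ∣ x' - x := by
        refine Finset.prod_dvd_of_coprime ?_ ?_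
        · intro p hp q hq hpq
          exact Nat.isCoprime_iff_coprime.mpr
            ((Nat.coprime_primes (hT p hp).1 (hT q hq).1).mpr hpq)
        · intro p hp
          exact Int.ModEq.dvd (congrFun (congrFun h p) hp)
      push_cast at hb hb'
      have h0 : x' - x = 0 := by
        refine Int.eq_zero_of_abs_lt_dvd hdvd ?_
        rw [abs_lt]
        constructor <;> linarith
      linarith
  rw [Finset.card_pi] at h1
  calc 2 ^ T.card * W.card ≤ 2 ^ T.card * ∏ p ∈ T, (circleResidues p M).card :=
        Nat.mul_le_mul_left _ h1
    _ = ∏ p ∈ T, 2 * (circleResidues p M).card := by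
        rw [Finset.prod_mul_distrib, Finset.prod_const]
    _ ≤ ∏ p ∈ T, (p + 6) := Finset.prod_le_prod' fun p hp =>
        two_mul_card_circleResidues_le (hT p hp).1 (hT p hp).2 M

/-- The abscissae of the lattice points of a circle have density zero, uniformly in the circle. -/
theorem exists_window_card_lattice_abscissae_le {ε : ℝ} (hε : 0 < ε) :
    ∃ L r : ℕ, 0 < L ∧ 0 < r ∧ (r : ℝ) ≤ ε * L ∧
      ∀ (M z : ℤ) (W : Finset ℤ),
        (∀ x ∈ W, z ≤ x ∧ x < z + L ∧ ∃ n : ℤ, x ^ 2 + n ^ 2 = M) → W.card ≤ r := by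
  obtain ⟨k, hk⟩ := exists_pow_lt_of_lt_one (half_pos hε) (by norm_num : (13 / 14 : ℝ) < 1)
  have hinf : {p : ℕ | p.Prime ∧ (p : ZMod 4) = 3}.Infinite :=
    Nat.infinite_setOfPred_prime_and_eq_mod (q := 4) (by decide)
  -- `p ≥ 7` gives `(p + 6) / 2 ≤ 13 p / 14`, and `p ≥ 2 / ε` absorbs the rounding of `r`
  have hinf' : ({p : ℕ | p.Prime ∧ (p : ZMod 4) = 3} \
      (Finset.range (7 + ⌈2 / ε⌉₊) : Finset ℕ)).Infinite :=
    hinf.sdiff (Finset.finite_toSet _)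
  obtain ⟨T, hTsub, hTcard⟩ := hinf'.exists_subset_card_eq (k + 1)
  have hT : ∀ p ∈ T, p.Prime ∧ p % 4 = 3 ∧ 7 + ⌈2 / ε⌉₊ ≤ p := by
    intro p hp
    obtain ⟨⟨h1, h2⟩, h3⟩ := hTsub hp
    refine ⟨h1, ?_, by simpa using h3⟩
    have : ((p : ℕ) : ZMod 4) = ((3 : ℕ) : ZMod 4) := by exact_mod_cast h2
    exact (ZMod.natCast_eq_natCast_iff' _ _ 4).mp this
  refine ⟨∏ p ∈ T, p, ⌈(13 / 14 : ℝ) ^ (k + 1) * ((∏ p ∈ T, p : ℕ) : ℝ)⌉₊, ?_, ?_, ?_, ?_⟩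
  · exact Finset.prod_pos fun p hp => (hT p hp).1.pos
  · refine Nat.ceil_pos.mpr (mul_pos (by positivity) ?_)
    exact_mod_cast Finset.prod_pos fun p hp => (hT p hp).1.pos
  · have hP : 2 / ε ≤ ((∏ p ∈ T, p : ℕ) : ℝ) := by
      obtain ⟨p, hp⟩ : T.Nonempty := by
        rw [← Finset.card_pos, hTcard]; omega
      have h1 : p ≤ ∏ p ∈ T, p :=
        Nat.le_of_dvd (Finset.prod_pos fun p hp => (hT p hp).1.pos) (Finset.dvd_prod_of_mem _ hp)
      have h2 : ⌈2 / ε⌉₊ ≤ ∏ p ∈ T, p := by have := (hT p hp).2.2; omega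
      exact (Nat.le_ceil _).trans (by exact_mod_cast h2)
    have hP' : 1 ≤ ε / 2 * ((∏ p ∈ T, p : ℕ) : ℝ) := by
      rw [div_le_iff₀ hε] at hP
      linarith
    have hk' : (13 / 14 : ℝ) ^ (k + 1) ≤ ε / 2 := by
      rw [pow_succ]
      have : (0 : ℝ) < (13 / 14) ^ k := by positivity
      nlinarith
    have := Nat.ceil_lt_add_one (a := (13 / 14 : ℝ) ^ (k + 1) * ((∏ p ∈ T, p : ℕ) : ℝ))
      (by positivity)
    have := mul_le_mul_of_nonneg_right hk' (Nat.cast_nonneg (α := ℝ) (∏ p ∈ T, p))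
    linarith
  · intro M z W hW
    have h1 := card_lattice_abscissae_le T (fun p hp => ⟨(hT p hp).1, (hT p hp).2.1⟩) M z W hW
    have h2 : (14 : ℕ) ^ T.card * ∏ p ∈ T, (p + 6) ≤ 26 ^ T.card * ∏ p ∈ T, p := by
      rw [← Finset.prod_const, ← Finset.prod_const, ← Finset.prod_mul_distrib,
        ← Finset.prod_mul_distrib]
      refine Finset.prod_le_prod' fun p hp => ?_
      have := (hT p hp).2.2
      omega
    have h3 : (28 : ℝ) ^ (k + 1) * W.card ≤ 26 ^ (k + 1) * ((∏ p ∈ T, p : ℕ) : ℝ) := by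
      rw [hTcard] at h1 h2
      have : 28 ^ (k + 1) * W.card ≤ 26 ^ (k + 1) * ∏ p ∈ T, p := by
        calc 28 ^ (k + 1) * W.card = 14 ^ (k + 1) * (2 ^ (k + 1) * W.card) := by
              rw [← mul_assoc, ← mul_pow]; norm_num
          _ ≤ _ := (Nat.mul_le_mul_left _ h1).trans h2
      exact_mod_cast this
    have h4 : (W.card : ℝ) ≤ (13 / 14 : ℝ) ^ (k + 1) * ((∏ p ∈ T, p : ℕ) : ℝ) := by
      have h28 : (0 : ℝ) < 28 ^ (k + 1) := by positivity
      refine le_of_mul_le_mul_left (h3.trans (le_of_eq ?_)) h28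
      rw [← mul_assoc, ← mul_pow]
      norm_num
    exact_mod_cast h4.trans (Nat.le_ceil _)

/-! ### Fourier transforms of functions with small support -/

/-- The exponential `y ↦ e^{i k y}`. -/
noncomputable def wave (k : ℤ) (y : ℝ) : ℂ := Complex.exp (((k : ℝ) * y : ℝ) * Complex.I)

theorem norm_wave (k : ℤ) (y : ℝ) : ‖wave k y‖ = 1 := Complex.norm_exp_ofReal_mul_I _

theorem continuous_wave (k : ℤ) : Continuous (wave k) := by unfold wave; fun_prop

theorem wave_zero (y : ℝ) : wave 0 y = 1 := by simp [wave]

theorem wave_add_left (k l : ℤ) (y : ℝ) : wave (k + l) y = wave k y * wave l y := by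
  rw [wave, wave, wave, ← Complex.exp_add]
  congr 1; push_cast; ring

theorem wave_add_right (k : ℤ) (x y : ℝ) : wave k (x + y) = wave k x * wave k y := by
  rw [wave, wave, wave, ← Complex.exp_add]
  congr 1; push_cast; ring

/-- `g` is the sequence of the numbers `∫ G(y) e^{iky} dy` of a continuous function `G` that
vanishes off `[-a, a]`. -/
def IsSymbol (a : ℝ) (g : ℤ → ℂ) : Prop :=
  ∃ G : ℝ → ℂ, Continuous G ∧ (∀ y, a < |y| → G y = 0) ∧ ∀ k, g k = ∫ y, G y * wave k y

theorem hasCompactSupport_of_abs {a : ℝ} {G : ℝ → ℂ} (hG : ∀ y, a < |y| → G y = 0) :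
    HasCompactSupport G := by
  refine HasCompactSupport.intro (isCompact_Icc (a := -a) (b := a)) fun y hy => hG y ?_
  by_contra h
  exact hy (abs_le.mp (not_lt.mp h))

theorem integrable_mul_wave {a : ℝ} {G : ℝ → ℂ} (hc : Continuous G)
    (hG : ∀ y, a < |y| → G y = 0) (k : ℤ) : Integrable fun y => G y * wave k y :=
  (hc.mul (continuous_wave k)).integrable_of_hasCompactSupport
    (hasCompactSupport_of_abs hG).mul_right

theorem IsSymbol.mono {a b : ℝ} (hab : a ≤ b) {g : ℤ → ℂ} (hg : IsSymbol a g) : IsSymbol b g := by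
  obtain ⟨G, hc, hs, hi⟩ := hg
  exact ⟨G, hc, fun y hy => hs y (hab.trans_lt hy), hi⟩

theorem IsSymbol.sum {ι : Type*} (T : Finset ι) {a : ℝ} (d : ι → ℂ) {g : ι → ℤ → ℂ}
    (hg : ∀ t ∈ T, IsSymbol a (g t)) : IsSymbol a fun k => ∑ t ∈ T, d t * g t k := by
  classical
  have hg' : ∀ t, ∃ G : ℝ → ℂ, t ∈ T → Continuous G ∧ (∀ y, a < |y| → G y = 0) ∧
      ∀ k, g t k = ∫ y, G y * wave k y := by
    intro t
    by_cases ht : t ∈ T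
    · obtain ⟨G, h⟩ := hg t ht
      exact ⟨G, fun _ => h⟩
    · exact ⟨0, fun h => absurd h ht⟩
  choose G hG using hg'
  refine ⟨fun y => ∑ t ∈ T, d t * G t y, ?_, ?_, ?_⟩
  · exact continuous_finsetSum _ fun t ht => continuous_const.mul (hG t ht).1
  · intro y hy
    exact Finset.sum_eq_zero fun t ht => by rw [(hG t ht).2.1 y hy, mul_zero]
  · intro k
    simp_rw [Finset.sum_mul, mul_assoc]
    rw [integral_finsetSum]
    · refine Finset.sum_congr rfl fun t ht => ?_
      rw [(hG t ht).2.2 k, integral_const_mul]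
    · intro t ht
      exact (integrable_mul_wave (hG t ht).1 (hG t ht).2.1 k).const_mul _

theorem IsSymbol.translate {a : ℝ} {g : ℤ → ℂ} (hg : IsSymbol a g) (t : ℤ) :
    IsSymbol a fun k => g (k - t) := by
  obtain ⟨G, hc, hs, hi⟩ := hg
  refine ⟨fun y => G y * wave (-t) y, hc.mul (continuous_wave _), ?_, ?_⟩
  · intro y hy
    simp [hs y hy]
  · intro k
    refine (hi _).trans ?_
    congr 1
    ext y
    rw [mul_assoc, ← wave_add_left]
    congr 2
    ring

theorem IsSymbol.mul {a b : ℝ} {g h : ℤ → ℂ} (hg : IsSymbol a g) (hh : IsSymbol b h) :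
    IsSymbol (a + b) fun k => g k * h k := by
  obtain ⟨G, hGc, hGs, hGi⟩ := hg
  obtain ⟨H, hHc, hHs, hHi⟩ := hh
  refine ⟨convolution G H (ContinuousLinearMap.mul ℂ ℂ) volume, ?_, ?_, ?_⟩
  · exact (hasCompactSupport_of_abs hHs).continuous_convolution_right _
      hGc.locallyIntegrable hHc
  · intro y hy
    rw [convolution_def]
    refine integral_eq_zero_of_ae (Filter.Eventually.of_forall fun t => ?_)
    by_cases ht : a < |t|
    · simp [hGs t ht]
    · have : b < |y - t| := by
        have := abs_sub_abs_le_abs_sub y t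
        linarith
      simp [hHs _ this]
  · intro k
    have h := integral_convolution (ContinuousLinearMap.mul ℂ ℂ) (μ := volume) (ν := volume)
      (integrable_mul_wave hGc hGs k) (integrable_mul_wave hHc hHs k)
    refine (congrArg₂ (· * ·) (hGi k) (hHi k)).trans ?_
    refine h.symm.trans (integral_congr_ae (Filter.Eventually.of_forall fun x => ?_))
    simp only [convolution_def]
    rw [← integral_mul_const]
    congr 1
    ext t
    have : wave k x = wave k t * wave k (x - t) := by rw [← wave_add_right]; congr 1; ring
    simp only [ContinuousLinearMap.mul_apply', this]
    ring

theorem IsSymbol.wave_sub_mul {a : ℝ} {g : ℤ → ℂ} (hg : IsSymbol a g) {b : ℝ} (hb : 0 ≤ b)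
    (w : ℂ) : IsSymbol (a + b) fun k => (wave k b - w) * g k := by
  obtain ⟨G, hc, hs, hi⟩ := hg
  have hs' : ∀ y, a + b < |y| → G (y - b) = 0 := fun y hy => hs _ (by
    have := abs_sub_abs_le_abs_sub y b
    rw [abs_of_nonneg hb] at this
    linarith)
  have hs0 : ∀ y, a + b < |y| → G y = 0 := fun y hy => hs _ (by linarith)
  refine ⟨fun y => G (y - b) - w * G y, by fun_prop, ?_, ?_⟩
  · intro y hy
    simp [hs' y hy, hs0 y hy]
  · intro k
    simp_rw [sub_mul, mul_assoc]
    rw [integral_sub (integrable_mul_wave (by fun_prop) hs' k)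
      ((integrable_mul_wave hc hs k).const_mul w), integral_const_mul, ← hi]
    congr 1
    rw [← integral_add_right_eq_self (fun y => G (y - b) * wave k y) b, hi, ← integral_const_mul]
    congr 1
    ext y
    rw [wave_add_right, add_sub_cancel_right]
    ring

theorem hasDerivAt_wave (k : ℤ) (y : ℝ) :
    HasDerivAt (wave k) (Complex.I * k * wave k y) y := by
  have h1 : HasDerivAt (fun y : ℝ => (((k : ℝ) * y : ℝ) : ℂ) * Complex.I) ((k : ℂ) * Complex.I) y := by
    have := (((hasDerivAt_id y).const_mul (k : ℝ)).ofReal_comp).mul_const Complex.I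
    simpa using this
  refine h1.cexp.congr_deriv ?_
  change _ = Complex.I * k * Complex.exp _
  ring

/-- The triangle function on `[-a, a]`, the Fejér kernel on the Fourier side. -/
theorem exists_symbol_quadratic_decay {a : ℝ} (ha : 0 < a) :
    ∃ h : ℤ → ℂ, IsSymbol a h ∧ h 0 = a ∧ ∀ k ≠ 0, ‖h k‖ ≤ 4 / a * (1 / (k : ℝ) ^ 2) := by
  set G : ℝ → ℂ := fun y => ((max 0 (1 - |y| / a) : ℝ) : ℂ) with hG
  have hc : Continuous G := by rw [hG]; fun_prop
  have hs : ∀ y, a < |y| → G y = 0 := by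
    intro y hy
    have : 1 - |y| / a ≤ 0 := by
      rw [sub_nonpos, le_div_iff₀ ha]; linarith
    simp [hG, max_eq_left this]
  have haC : (a : ℂ) ≠ 0 := by exact_mod_cast ha.ne'
  have hsplit : ∀ k : ℤ, ∫ y, G y * wave k y =
      (∫ y in (-a)..0, (1 + y / a : ℂ) * wave k y) + ∫ y in (0)..a, (1 - y / a : ℂ) * wave k y := by
    intro k
    have h1 : ∫ y, G y * wave k y = ∫ y in Set.Ioc (-a) a, G y * wave k y := by
      refine (setIntegral_eq_integral_of_forall_compl_eq_zero fun y hy => ?_).symm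
      rcases lt_trichotomy |y| a with h | h | h
      · exact absurd ⟨(abs_lt.mp h).1, (abs_lt.mp h).2.le⟩ hy
      · simp [hG, h, div_self ha.ne']
      · simp [hs y h]
    have hint : ∀ c d : ℝ, IntervalIntegrable (fun y => G y * wave k y) volume c d := fun c d =>
      (hc.mul (continuous_wave k)).intervalIntegrable _ _
    rw [h1, ← intervalIntegral.integral_of_le (by linarith),
      ← intervalIntegral.integral_add_adjacent_intervals (hint (-a) 0) (hint 0 a)]
    congr 1
    · refine intervalIntegral.integral_congr fun y hy => ?_
      rw [Set.uIcc_of_le (by linarith)] at hy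
      have h2 : 0 ≤ 1 + y / a := by
        have : -1 ≤ y / a := by rw [le_div_iff₀ ha]; linarith [hy.1]
        linarith
      simp only [hG, abs_of_nonpos hy.2, neg_div, sub_neg_eq_add, max_eq_right h2]
      push_cast; rfl
    · refine intervalIntegral.integral_congr fun y hy => ?_
      rw [Set.uIcc_of_le (by linarith)] at hy
      have h2 : 0 ≤ 1 - y / a := by
        have : y / a ≤ 1 := by rw [div_le_iff₀ ha]; linarith [hy.2]
        linarith
      simp only [hG, abs_of_nonneg hy.1, max_eq_right h2]
      push_cast; rfl
  have hdy : ∀ y : ℝ, HasDerivAt (fun y : ℝ => (y : ℂ)) 1 y := fun y =>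
    (hasDerivAt_id y).ofReal_comp
  refine ⟨fun k => ∫ y, G y * wave k y, ⟨G, hc, hs, fun _ => rfl⟩, ?_, ?_⟩
  · have h0 := hsplit 0
    simp only [wave_zero, mul_one] at h0 ⊢
    rw [h0, intervalIntegral.integral_eq_sub_of_hasDerivAt
        (f := fun y : ℝ => (y + (y : ℂ) ^ 2 / (2 * a) : ℂ)),
      intervalIntegral.integral_eq_sub_of_hasDerivAt
        (f := fun y : ℝ => (y - (y : ℂ) ^ 2 / (2 * a) : ℂ))]
    · push_cast; field_simp; ring
    · intro y _
      have := (hdy y).sub (((hdy y).pow 2).div_const (2 * (a : ℂ)))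
      convert! this using 1
      push_cast; field_simp
    · exact (by fun_prop : Continuous fun y : ℝ => (1 - y / a : ℂ)).intervalIntegrable _ _
    · intro y _
      have := (hdy y).add (((hdy y).pow 2).div_const (2 * (a : ℂ)))
      convert! this using 1
      push_cast; field_simp
    · exact (by fun_prop : Continuous fun y : ℝ => (1 + y / a : ℂ)).intervalIntegrable _ _
  · intro k hk
    have hkC : (k : ℂ) ≠ 0 := by exact_mod_cast hk
    have hw := continuous_wave k
    have hval : ∫ y, G y * wave k y = (2 - wave k (-a) - wave k a) / (a * (k : ℂ) ^ 2) := by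
      rw [hsplit, intervalIntegral.integral_eq_sub_of_hasDerivAt
          (f := fun y : ℝ => ((1 + y / a) / (Complex.I * k) + 1 / (a * (k : ℂ) ^ 2)) * wave k y),
        intervalIntegral.integral_eq_sub_of_hasDerivAt
          (f := fun y : ℝ => ((1 - y / a) / (Complex.I * k) - 1 / (a * (k : ℂ) ^ 2)) * wave k y)]
      · have h0 : wave k 0 = 1 := by simp [wave]
        rw [h0]
        push_cast; field_simp; ring
      · intro y _
        have := (((((hdy y).div_const (a : ℂ)).const_sub 1).div_const (Complex.I * k)).sub_const
          (1 / (a * (k : ℂ) ^ 2))).mul (hasDerivAt_wave k y)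
        convert! this using 1
        field_simp
        linear_combination wave k y * Complex.I_sq
      · exact (by fun_prop : Continuous fun y : ℝ => (1 - y / a : ℂ) * wave k y).intervalIntegrable _ _
      · intro y _
        have := (((((hdy y).div_const (a : ℂ)).const_add 1).div_const (Complex.I * k)).add_const
          (1 / (a * (k : ℂ) ^ 2))).mul (hasDerivAt_wave k y)
        convert! this using 1
        field_simp
        linear_combination (-wave k y) * Complex.I_sq
      · exact (by fun_prop : Continuous fun y : ℝ => (1 + y / a : ℂ) * wave k y).intervalIntegrable _ _
    have hn : ‖(2 - wave k (-a) - wave k a : ℂ)‖ ≤ 4 := by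
      refine (norm_sub_le _ _).trans ?_
      have := norm_sub_le (2 : ℂ) (wave k (-a))
      rw [norm_wave] at *
      norm_num at this
      linarith
    simp only [hval]
    rw [norm_div, norm_mul, norm_pow, Complex.norm_real, Complex.norm_intCast, Real.norm_eq_abs,
      abs_of_pos ha, sq_abs, div_mul_div_comm, mul_one]
    gcongr

/-! ### Lower bounds for trigonometric sums -/

theorem summable_inv_int_sq : Summable fun j : ℤ => 1 / (j : ℝ) ^ 2 :=
  Real.summable_one_div_int_pow.mpr one_lt_two

theorem sum_inv_sq_le_of_gap {L : ℕ} (hL : 0 < L) {Λ : Finset ℤ}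
    (hgap : ∀ s ∈ Λ, ∀ t ∈ Λ, s ≠ t → (L : ℤ) ≤ |s - t|) {s : ℤ} (hs : s ∈ Λ) :
    ∑ t ∈ Λ.erase s, 1 / ((s - t : ℤ) : ℝ) ^ 2 ≤
      4 * (∑' j : ℤ, 1 / (j : ℝ) ^ 2) / (L : ℝ) ^ 2 := by
  have hL' : (0 : ℤ) < L := by exact_mod_cast hL
  have hLR : (0 : ℝ) < L := by exact_mod_cast hL
  set q : ℤ → ℤ := fun t => (s - t) / L with hq
  -- the quotients by `L` of the differences are distinct and nonzero: compare with `∑ 1 / j ^ 2`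
  have hinj : Set.InjOn q (Λ.erase s : Finset ℤ) := by
    intro t ht t' ht' h
    by_contra hne
    have h1 := hgap t (Finset.mem_of_mem_erase ht) t' (Finset.mem_of_mem_erase ht') hne
    have e1 := Int.mul_ediv_add_emod (s - t) L
    have e2 := Int.mul_ediv_add_emod (s - t') L
    have b1 := Int.emod_nonneg (s - t) hL'.ne'
    have b2 := Int.emod_nonneg (s - t') hL'.ne'
    have c1 := Int.emod_lt_of_pos (s - t) hL'
    have c2 := Int.emod_lt_of_pos (s - t') hL'
    have h' : (s - t) / (L : ℤ) = (s - t') / L := h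
    rw [h'] at e1
    rcases le_abs.mp h1 with h1 | h1 <;> linarith
  have hterm : ∀ t ∈ Λ.erase s,
      1 / ((s - t : ℤ) : ℝ) ^ 2 ≤ 4 / (L : ℝ) ^ 2 * (1 / (q t : ℝ) ^ 2) := by
    intro t ht
    obtain ⟨hts, ht⟩ := Finset.mem_erase.mp ht
    have h1 := hgap s hs t ht (Ne.symm hts)
    have e1 := Int.mul_ediv_add_emod (s - t) L
    have b1 := Int.emod_nonneg (s - t) hL'.ne'
    have c1 := Int.emod_lt_of_pos (s - t) hL'
    have hq0 : q t ≠ 0 ∧ (L * q t) ^ 2 ≤ (2 * (s - t)) ^ 2 := by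
      have hqt : q t = (s - t) / L := rfl
      rw [← hqt] at e1
      constructor
      · intro h
        rw [h] at e1
        rcases le_abs.mp h1 with h1 | h1 <;> linarith
      · rw [sq_le_sq]
        rcases le_abs.mp h1 with h1 | h1
        · rw [abs_of_nonneg (by linarith), abs_of_nonneg (by linarith)]; linarith
        · rw [abs_of_nonpos (by linarith), abs_of_nonpos (by linarith)]; linarith
    have hpos : (0 : ℝ) < ((L : ℝ) * q t) ^ 2 := by
      have : (q t : ℝ) ≠ 0 := by exact_mod_cast hq0.1
      positivity
    have hle : ((L : ℝ) * q t) ^ 2 ≤ (2 * ((s - t : ℤ) : ℝ)) ^ 2 := by exact_mod_cast hq0.2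
    have hst : ((s - t : ℤ) : ℝ) ≠ 0 := by
      have : s - t ≠ 0 := sub_ne_zero.mpr (Ne.symm hts)
      exact_mod_cast this
    rw [div_mul_div_comm, mul_one, ← mul_pow, div_le_div_iff₀ (by positivity) hpos]
    linarith
  calc ∑ t ∈ Λ.erase s, 1 / ((s - t : ℤ) : ℝ) ^ 2
      ≤ ∑ t ∈ Λ.erase s, 4 / (L : ℝ) ^ 2 * (1 / (q t : ℝ) ^ 2) := Finset.sum_le_sum hterm
    _ = 4 / (L : ℝ) ^ 2 * ∑ j ∈ (Λ.erase s).image q, 1 / (j : ℝ) ^ 2 := by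
        rw [← Finset.mul_sum, Finset.sum_image hinj]
    _ ≤ 4 / (L : ℝ) ^ 2 * ∑' j : ℤ, 1 / (j : ℝ) ^ 2 := by
        gcongr
        exact summable_inv_int_sq.sum_le_tsum _ fun j _ => by positivity
    _ = _ := by ring

/-- For a set with gaps `≥ L` the Gram matrix of the triangle kernel of width `a ~ 1 / L` is
strictly diagonally dominant; inverting it yields a biorthogonal function for the frequency `0`. -/
theorem exists_symbol_of_gap {L : ℕ} (hL : 0 < L) {a : ℝ} (ha : 0 < a)
    (haL : 32 * (∑' j : ℤ, 1 / (j : ℝ) ^ 2) ≤ a ^ 2 * (L : ℝ) ^ 2) :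
    ∃ C : ℝ, ∀ Λ : Finset ℤ, 0 ∈ Λ →
      (∀ s ∈ Λ, ∀ t ∈ Λ, s ≠ t → (L : ℤ) ≤ |s - t|) →
      ∃ g : ℤ → ℂ, IsSymbol a g ∧ g 0 = 1 ∧ (∀ s ∈ Λ, s ≠ 0 → g s = 0) ∧ ∀ k, ‖g k‖ ≤ C := by
  classical
  obtain ⟨h, hsym, h0, hdec⟩ := exists_symbol_quadratic_decay ha
  have hLR : (0 : ℝ) < L := by exact_mod_cast hL
  have hsummable : Summable fun k => ‖h k‖ := by
    refine (summable_inv_int_sq.mul_left (4 / a)).of_norm_bounded_eventually ?_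
    filter_upwards [(Set.finite_singleton (0 : ℤ)).compl_mem_cofinite] with k hk
    rw [norm_norm]
    exact hdec k hk
  refine ⟨2 / a * ∑' k, ‖h k‖, fun Λ h0Λ hgap => ?_⟩
  have hoff : ∀ s ∈ Λ, ∑ t ∈ Λ.erase s, ‖h (s - t)‖ ≤ a / 2 := by
    intro s hs
    calc ∑ t ∈ Λ.erase s, ‖h (s - t)‖
        ≤ ∑ t ∈ Λ.erase s, 4 / a * (1 / ((s - t : ℤ) : ℝ) ^ 2) :=
          Finset.sum_le_sum fun t ht =>
            hdec _ (sub_ne_zero.mpr (Ne.symm (Finset.ne_of_mem_erase ht)))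
      _ ≤ 4 / a * (4 * (∑' j : ℤ, 1 / (j : ℝ) ^ 2) / (L : ℝ) ^ 2) := by
          rw [← Finset.mul_sum]
          gcongr
          exact sum_inv_sq_le_of_gap hL hgap hs
      _ ≤ a / 2 := by
          rw [div_mul_div_comm, div_le_div_iff₀ (by positivity) two_pos]
          nlinarith
  let A : Matrix Λ Λ ℂ := fun s t => h (s - t)
  have hdet : A.det ≠ 0 := by
    refine det_ne_zero_of_sum_row_lt_diag fun s => ?_
    have h1 : ∑ t ∈ Finset.univ.erase s, ‖A s t‖ = ∑ t ∈ Λ.erase (s : ℤ), ‖h (s - t)‖ := by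
      refine Finset.sum_bij (fun t _ => (t : ℤ)) ?_ ?_ ?_ ?_
      · intro t ht
        exact Finset.mem_erase.mpr
          ⟨fun h => Finset.ne_of_mem_erase ht (Subtype.ext h), t.2⟩
      · intro t _ t' _ h
        exact Subtype.ext h
      · intro t ht
        exact ⟨⟨t, Finset.mem_of_mem_erase ht⟩, Finset.mem_erase.mpr
          ⟨fun h => Finset.ne_of_mem_erase ht (congrArg Subtype.val h), Finset.mem_univ _⟩, rfl⟩
      · intro t _
        rfl
    have h2 : ‖A s s‖ = a := by
      simp [A, h0, abs_of_pos ha]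
    rw [h1, h2]
    exact (hoff s s.2).trans_lt (by linarith)
  obtain ⟨d', hd'⟩ := (Matrix.mulVec_surjective_iff_isUnit.mpr
    ((Matrix.isUnit_iff_isUnit_det A).mpr (isUnit_iff_ne_zero.mpr hdet)))
    (Pi.single ⟨0, h0Λ⟩ 1)
  set d : ℤ → ℂ := fun t => if ht : t ∈ Λ then d' ⟨t, ht⟩ else 0 with hd
  have hsolve : ∀ s ∈ Λ, ∑ t ∈ Λ, d t * h (s - t) = if s = 0 then 1 else 0 := by
    intro s hs
    have := congrFun hd' ⟨s, hs⟩
    rw [Matrix.mulVec, dotProduct] at this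
    rw [← Finset.sum_coe_sort]
    convert! this using 1
    · refine Finset.sum_congr rfl fun t _ => ?_
      simp only [hd, A, t.2, dif_pos]
      ring
    · simp [Pi.single_apply]
  -- diagonal dominance, at a coefficient of largest modulus, bounds the solution
  have hdbound : ∀ t ∈ Λ, ‖d t‖ ≤ 2 / a := by
    obtain ⟨s, hs, hmax⟩ := Λ.exists_max_image (fun t => ‖d t‖) ⟨0, h0Λ⟩
    have h1 := hsolve s hs
    rw [← Finset.add_sum_erase _ _ hs, sub_self, h0] at h1
    have h2 : ‖d s‖ * a ≤ 1 + ‖d s‖ * (a / 2) := by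
      calc ‖d s‖ * a = ‖d s * (a : ℂ)‖ := by
            rw [norm_mul, Complex.norm_real, Real.norm_eq_abs, abs_of_pos ha]
        _ = ‖(if s = 0 then 1 else 0 : ℂ) - ∑ t ∈ Λ.erase s, d t * h (s - t)‖ := by
            rw [← h1, add_sub_cancel_right]
        _ ≤ ‖(if s = 0 then 1 else 0 : ℂ)‖ + ∑ t ∈ Λ.erase s, ‖d t * h (s - t)‖ :=
            (norm_sub_le _ _).trans (add_le_add_right (norm_sum_le _ _) _)
        _ ≤ 1 + ∑ t ∈ Λ.erase s, ‖d s‖ * ‖h (s - t)‖ := by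
            gcongr with t ht
            · split_ifs <;> simp
            · rw [norm_mul]
              gcongr
              exact hmax t (Finset.mem_of_mem_erase ht)
        _ ≤ 1 + ‖d s‖ * (a / 2) := by
            rw [← Finset.mul_sum]
            gcongr
            exact hoff s hs
    intro t ht
    refine (hmax t ht).trans ?_
    rw [le_div_iff₀ ha]
    linarith
  refine ⟨fun k => ∑ t ∈ Λ, d t * h (k - t),
    IsSymbol.sum Λ d (fun t _ => hsym.translate t), ?_, ?_, ?_⟩
  · simpa using hsolve 0 h0Λ
  · intro s hs hs0
    simpa [hs0] using hsolve s hs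
  · intro k
    calc ‖∑ t ∈ Λ, d t * h (k - t)‖ ≤ ∑ t ∈ Λ, 2 / a * ‖h (k - t)‖ := by
          refine (norm_sum_le _ _).trans (Finset.sum_le_sum fun t ht => ?_)
          rw [norm_mul]
          gcongr
          exact hdbound t ht
      _ = 2 / a * ∑ j ∈ Λ.image (fun t => k - t), ‖h j‖ := by
          rw [← Finset.mul_sum, Finset.sum_image (fun t _ t' _ => sub_right_inj.mp)]
      _ ≤ 2 / a * ∑' j, ‖h j‖ := by
          gcongr
          exact hsummable.sum_le_tsum _ fun j _ => norm_nonneg _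

/-- Killing the finitely many frequencies close to `0` by translations of length `1 / L`. -/
theorem exists_symbol_killing_near {L : ℕ} (hL : 0 < L) :
    ∃ D : ℝ, 1 ≤ D ∧ ∀ (N : Finset ℤ), (∀ s ∈ N, s ≠ 0 ∧ |s| < L) →
      ∀ (a : ℝ) (g : ℤ → ℂ), IsSymbol a g → g 0 = 1 →
      ∃ g' : ℤ → ℂ, IsSymbol (a + N.card * (1 / L)) g' ∧ g' 0 = 1 ∧ (∀ s ∈ N, g' s = 0) ∧
        (∀ s, g s = 0 → g' s = 0) ∧ ∀ k, ‖g' k‖ ≤ D ^ N.card * ‖g k‖ := by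
  classical
  have hLR : (0 : ℝ) < L := by exact_mod_cast hL
  set b : ℝ := 1 / L with hb
  have hb0 : 0 < b := by positivity
  set D : ℝ := 1 + ∑ s ∈ Finset.Ioo (-(L : ℤ)) L, 2 / ‖1 - wave s b‖ with hD
  have hD1 : 1 ≤ D := by
    rw [hD]
    have : 0 ≤ ∑ s ∈ Finset.Ioo (-(L : ℤ)) L, 2 / ‖1 - wave s b‖ :=
      Finset.sum_nonneg fun s _ => by positivity
    linarith
  refine ⟨D, hD1, ?_⟩
  intro N
  induction N using Finset.induction_on with
  | empty =>
    intro _ a g hg hg0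
    exact ⟨g, by simpa using hg, hg0, by simp, fun _ h => h, by simp⟩
  | insert s N hsN ih =>
    intro hN a g hg hg0
    obtain ⟨g', hg', hg0', hN', hz, hbd⟩ :=
      ih (fun t ht => hN t (Finset.mem_insert_of_mem ht)) a g hg hg0
    obtain ⟨hs0, hsL⟩ := hN s (Finset.mem_insert_self _ _)
    have hw : 1 - wave s b ≠ 0 := by
      intro h
      have h1 : wave s b = 1 := (sub_eq_zero.mp h).symm
      rw [wave, Complex.exp_eq_one_iff] at h1
      obtain ⟨n, hn⟩ := h1
      have h2 : (s : ℝ) * b = n * (2 * Real.pi) := by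
        have : (((s : ℝ) * b : ℝ) : ℂ) = ((n * (2 * Real.pi) : ℝ) : ℂ) := by
          refine mul_right_cancel₀ Complex.I_ne_zero (hn.trans ?_)
          push_cast; ring
        exact_mod_cast this
      have h3 : |(s : ℝ) * b| < 1 := by
        rw [abs_mul, abs_of_pos hb0, hb, mul_one_div, div_lt_one hLR]
        exact_mod_cast hsL
      have hn0 : n ≠ 0 := by
        rintro rfl
        have : (s : ℝ) ≠ 0 := by exact_mod_cast hs0
        have : (s : ℝ) * b ≠ 0 := mul_ne_zero this hb0.ne'
        apply this
        simpa using h2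
      have h4 : (1 : ℝ) ≤ |(n : ℝ)| := by exact_mod_cast Int.one_le_abs hn0
      rw [h2, abs_mul, abs_of_pos Real.two_pi_pos] at h3
      nlinarith [Real.pi_gt_three]
    have hcoef : 2 / ‖1 - wave s b‖ ≤ D := by
      have h1 : s ∈ Finset.Ioo (-(L : ℤ)) L := Finset.mem_Ioo.mpr (abs_lt.mp hsL)
      have := Finset.single_le_sum (f := fun s => 2 / ‖1 - wave s b‖)
        (fun t _ => by positivity) h1
      rw [hD]
      linarith
    refine ⟨fun k => (1 - wave s b)⁻¹ * ((wave k b - wave s b) * g' k), ?_, ?_, ?_, ?_, ?_⟩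
    · have h1 := (hg'.wave_sub_mul hb0.le (wave s b))
      have h2 := IsSymbol.sum {(0 : ℤ)} (fun _ => (1 - wave s b)⁻¹)
        (g := fun _ k => (wave k b - wave s b) * g' k) (fun _ _ => h1)
      simp only [Finset.sum_singleton] at h2
      refine h2.mono (le_of_eq ?_)
      rw [Finset.card_insert_of_notMem hsN]
      push_cast
      ring
    · simp [wave_zero, hg0', inv_mul_cancel₀ hw]
    · intro t ht
      rcases Finset.mem_insert.mp ht with rfl | ht
      · simp
      · simp [hN' t ht]
    · intro t ht
      simp [hz t ht]
    · intro k
      have h2 : ‖wave k b - wave s b‖ ≤ 2 := by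
        refine (norm_sub_le _ _).trans ?_
        rw [norm_wave, norm_wave]; norm_num
      calc ‖(1 - wave s b)⁻¹ * ((wave k b - wave s b) * g' k)‖
          = ‖wave k b - wave s b‖ / ‖1 - wave s b‖ * ‖g' k‖ := by
            rw [norm_mul, norm_mul, norm_inv]; ring
        _ ≤ D * (D ^ N.card * ‖g k‖) := by
            gcongr
            · exact (div_le_div_of_nonneg_right h2 (norm_nonneg _)).trans hcoef
            · exact hbd k
        _ = D ^ (insert s N).card * ‖g k‖ := by
            rw [Finset.card_insert_of_notMem hsN, pow_succ]; ring

/-- If every window of `L` integers contains at most `r` points of `S`, then the points of `S` with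
the same rank modulo `r` are at distance at least `L` of each other. -/
theorem gap_of_rank_modEq {L r : ℕ} {S : Finset ℤ}
    (hwin : ∀ z : ℤ, (S.filter fun x => z ≤ x ∧ x < z + L).card ≤ r) {s t : ℤ} (hs : s ∈ S)
    (ht : t ∈ S) (hst : s < t)
    (hmod : (S.filter (· < s)).card % r = (S.filter (· < t)).card % r) : (L : ℤ) ≤ t - s := by
  classical
  by_contra! hlt
  have hsub : S.filter (· < s) ⊆ S.filter (· < t) :=
    Finset.monotone_filter_right _ fun x _ hx => lt_trans hx hst
  have hcard := Finset.card_sdiff_add_card_eq_card hsub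
  set W := S.filter (· < t) \ S.filter (· < s) with hW
  have hsW : s ∈ W := by simp [hW, hs, hst]
  have htW : t ∉ W := by simp [hW]
  have hle : (insert t W).card ≤ r := by
    refine (Finset.card_le_card fun x hx => ?_).trans (hwin s)
    rcases Finset.mem_insert.mp hx with rfl | hx
    · exact Finset.mem_filter.mpr ⟨ht, hst.le, by linarith⟩
    · simp only [hW, Finset.mem_sdiff, Finset.mem_filter, not_and, not_lt] at hx
      exact Finset.mem_filter.mpr ⟨hx.1.1, hx.2 hx.1.1, by linarith [hx.1.2]⟩
  rw [Finset.card_insert_of_notMem htW] at hle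
  have hpos : 0 < W.card := Finset.card_pos.mpr ⟨s, hsW⟩
  have h1 : r ∣ W.card := by
    have := (Nat.modEq_iff_dvd' (Finset.card_le_card hsub)).mp hmod
    rwa [← hcard, Nat.add_sub_cancel] at this
  have := Nat.le_of_dvd hpos h1
  omega

/-- A set with few points in each window of length `L` splits into `r` sets with gaps `≥ L` and
the points near `0`; the product of the symbols of these pieces and of a triangle kernel, which
provides summable decay, singles out the frequency `0`. -/
theorem exists_symbol_of_window {L r : ℕ} (hL : 0 < L) (hr : 0 < r) {a b : ℝ} (ha : 0 < a)
    (haL : 32 * (∑' j : ℤ, 1 / (j : ℝ) ^ 2) ≤ a ^ 2 * (L : ℝ) ^ 2) (hb : 0 < b) :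
    ∃ ρ : ℤ → ℝ, Summable ρ ∧ (∀ k, 0 ≤ ρ k) ∧ ∀ S : Finset ℤ, 0 ∈ S →
      (∀ z : ℤ, (S.filter fun x => z ≤ x ∧ x < z + L).card ≤ r) →
      ∃ g : ℤ → ℂ, IsSymbol (b + r * a + 2 * r * (1 / L)) g ∧ g 0 = 1 ∧
        (∀ s ∈ S, s ≠ 0 → g s = 0) ∧ ∀ k, ‖g k‖ ≤ ρ k := by
  classical
  obtain ⟨h, hsym, h0, hdec⟩ := exists_symbol_quadratic_decay hb
  obtain ⟨C, hC⟩ := exists_symbol_of_gap hL ha haL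
  obtain ⟨D, hD1, hD⟩ := exists_symbol_killing_near hL
  have hbC : (b : ℂ) ≠ 0 := by exact_mod_cast hb.ne'
  have hsummable : Summable fun k => ‖h k‖ := by
    refine (summable_inv_int_sq.mul_left (4 / b)).of_norm_bounded_eventually ?_
    filter_upwards [(Set.finite_singleton (0 : ℤ)).compl_mem_cofinite] with k hk
    rw [norm_norm]
    exact hdec k hk
  have hC0 : 0 ≤ C := by
    obtain ⟨g, -, -, -, hg⟩ := hC {0} (by simp) (by simp)
    exact (norm_nonneg _).trans (hg 0)
  refine ⟨fun k => D ^ (2 * r) * (C ^ r * (b⁻¹ * ‖h k‖)),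
    ((hsummable.mul_left _).mul_left _).mul_left _, fun k => by positivity, fun S h0S hwin => ?_⟩
  set rank : ℤ → ℕ := fun s => (S.filter (· < s)).card % r with hrank
  -- the points of `S` at distance at least `L` of `0`, one rank modulo `r` after the other
  have hclasses : ∀ n : ℕ, ∃ g : ℤ → ℂ, IsSymbol (b + n * a) g ∧ g 0 = 1 ∧
      (∀ s ∈ S, rank s < n → (L : ℤ) ≤ |s| → g s = 0) ∧
      ∀ k, ‖g k‖ ≤ C ^ n * (b⁻¹ * ‖h k‖) := by
    intro n
    induction n with
    | zero =>
      refine ⟨fun k => (b : ℂ)⁻¹ * h k, ?_, ?_, by simp, ?_⟩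
      · have := IsSymbol.sum {(0 : ℤ)} (fun _ => (b : ℂ)⁻¹) (g := fun _ => h) (fun _ _ => hsym)
        simpa using this
      · simp [h0, hbC]
      · intro k
        rw [norm_mul, norm_inv, Complex.norm_real, Real.norm_eq_abs, abs_of_pos hb]
        simp
    | succ n ih =>
      obtain ⟨g, hg, hg0, hgz, hgb⟩ := ih
      set Λ := insert 0 (S.filter fun s => rank s = n ∧ (L : ℤ) ≤ |s|) with hΛ
      have hgap : ∀ s ∈ Λ, ∀ t ∈ Λ, s ≠ t → (L : ℤ) ≤ |s - t| := by
        intro s hs t ht hst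
        rcases Finset.mem_insert.mp hs with rfl | hs <;>
          rcases Finset.mem_insert.mp ht with rfl | ht
        · exact absurd rfl hst
        · simpa using (Finset.mem_filter.mp ht).2.2
        · simpa using (Finset.mem_filter.mp hs).2.2
        · obtain ⟨hsS, hsn, -⟩ := Finset.mem_filter.mp hs
          obtain ⟨htS, htn, -⟩ := Finset.mem_filter.mp ht
          rcases lt_or_gt_of_ne hst with h | h
          · have := gap_of_rank_modEq hwin hsS htS h (hsn.trans htn.symm)
            rw [abs_sub_comm]
            exact this.trans (le_abs_self _)
          · exact (gap_of_rank_modEq hwin htS hsS h (htn.trans hsn.symm)).trans (le_abs_self _)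
      obtain ⟨g', hg', hg0', hgz', hgb'⟩ := hC Λ (Finset.mem_insert_self _ _) hgap
      refine ⟨fun k => g k * g' k, ?_, by simp [hg0, hg0'], ?_, ?_⟩
      · refine (hg.mul hg').mono (le_of_eq ?_)
        push_cast; ring
      · intro s hs hsn hsL
        rcases Nat.lt_succ_iff_lt_or_eq.mp hsn with h | h
        · simp [hgz s hs h hsL]
        · have hs0 : s ≠ 0 := by
            rintro rfl
            simp at hsL
            omega
          have : g' s = 0 := hgz' s
            (Finset.mem_insert_of_mem (Finset.mem_filter.mpr ⟨hs, h, hsL⟩)) hs0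
          simp [this]
      · intro k
        rw [norm_mul, pow_succ]
        calc ‖g k‖ * ‖g' k‖ ≤ (C ^ n * (b⁻¹ * ‖h k‖)) * C := by
              gcongr
              · exact hgb k
              · exact hgb' k
          _ = _ := by ring
  obtain ⟨g, hg, hg0, hgz, hgb⟩ := hclasses r
  set N : Finset ℤ := S.filter fun s : ℤ => s ≠ 0 ∧ |s| < (L : ℤ) with hN
  have hNcard : N.card ≤ 2 * r := by
    have hsub : N ⊆ (S.filter fun x => 0 ≤ x ∧ x < 0 + (L : ℤ)) ∪
        (S.filter fun x => -(L : ℤ) ≤ x ∧ x < -(L : ℤ) + L) := by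
      intro s hs
      obtain ⟨hsS, -, hsL⟩ := Finset.mem_filter.mp hs
      rw [abs_lt] at hsL
      simp only [Finset.mem_union, Finset.mem_filter, hsS, true_and]
      omega
    refine (Finset.card_le_card hsub).trans ((Finset.card_union_le _ _).trans ?_)
    have := hwin 0
    have := hwin (-(L : ℤ))
    omega
  obtain ⟨g', hg', hg0', hN0, hz, hgb'⟩ := hD N (fun s hs => (Finset.mem_filter.mp hs).2) _ g hg hg0
  refine ⟨g', hg'.mono ?_, hg0', ?_, ?_⟩
  · have h1 : (N.card : ℝ) ≤ 2 * r := by exact_mod_cast hNcard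
    exact add_le_add_right (mul_le_mul_of_nonneg_right h1 (by positivity)) _
  · intro s hs hs0
    by_cases hsL : |s| < (L : ℤ)
    · exact hN0 s (Finset.mem_filter.mpr ⟨hs, hs0, hsL⟩)
    · exact hz s (hgz s hs (Nat.mod_lt _ hr) (not_lt.mp hsL))
  · intro k
    exact (hgb' k).trans (mul_le_mul (pow_le_pow_right₀ hD1 hNcard) (hgb k) (norm_nonneg _)
      (by positivity))

theorem sum_comp_le_tsum {ρ : ℤ → ℝ} (hρ : Summable ρ) (h0 : ∀ k, 0 ≤ ρ k) (S : Finset ℤ)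
    {φ : ℤ → ℤ} (hφ : Function.Injective φ) : ∑ s ∈ S, ρ (φ s) ≤ ∑' k, ρ k := by
  classical
  rw [← Finset.sum_image (f := ρ) hφ.injOn]
  exact hρ.sum_le_tsum _ fun k _ => h0 k

/-- Parseval's identity for a continuous function supported in `[-A, A]`, `A < π`. -/
theorem hasSum_sq_symbol {A : ℝ} (hA : A < Real.pi) {F : ℝ → ℂ} (hF : Continuous F)
    (hs : ∀ y, A < |y| → F y = 0) :
    HasSum (fun k : ℤ => ‖∫ y, F y * wave (-k) y‖ ^ 2) (2 * Real.pi * ∫ y, ‖F y‖ ^ 2) := by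
  have hab : -Real.pi < Real.pi := by linarith [Real.pi_pos]
  have hL2 : MemLp F 2 (volume.restrict (Set.Ioc (-Real.pi) Real.pi)) :=
    ((hF.memLp_of_hasCompactSupport (hasCompactSupport_of_abs hs)).restrict _)
  have hsupp : ∀ {E : Type} [NormedAddCommGroup E] [NormedSpace ℝ E] (G : ℝ → E),
      (∀ y, A < |y| → G y = 0) → ∫ y in (-Real.pi)..Real.pi, G y = ∫ y, G y := by
    intro E _ _ G hG
    rw [intervalIntegral.integral_of_le hab.le]
    refine setIntegral_eq_integral_of_forall_compl_eq_zero fun y hy => hG y ?_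
    by_contra h
    have := abs_le.mp (not_lt.mp h)
    exact hy ⟨by linarith [this.1], by linarith [this.2]⟩
  have h := (hasSum_sq_fourierCoeffOn hab hL2).mul_left ((2 * Real.pi) ^ 2)
  have hpi : Real.pi - -Real.pi = 2 * Real.pi := by ring
  convert! h using 1
  · ext k
    rw [fourierCoeffOn_eq_integral, norm_smul, ← hsupp _ (fun y hy => by simp [hs y hy])]
    have h1 : ∫ y in (-Real.pi)..Real.pi, F y * wave (-k) y =
        ∫ x in (-Real.pi)..Real.pi,
          fourier (-k) (x : AddCircle (Real.pi - -Real.pi)) • F x := by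
      congr 1
      ext x
      rw [fourier_coe_apply, wave, smul_eq_mul, mul_comm]
      congr 2
      have : (Real.pi : ℂ) ≠ 0 := by exact_mod_cast Real.pi_ne_zero
      push_cast
      rw [show (Real.pi : ℂ) - -Real.pi = 2 * Real.pi by ring]
      field_simp
    rw [h1, hpi, mul_pow ‖_‖, Real.norm_eq_abs, sq_abs, ← mul_assoc, ← mul_pow]
    have : 2 * Real.pi * (1 / (2 * Real.pi)) = 1 := by
      have := Real.pi_ne_zero
      field_simp
    rw [this, one_pow, one_mul]
  · rw [hsupp _ (fun y hy => by simp [hs y hy]), hpi, smul_eq_mul]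
    have := Real.pi_ne_zero
    field_simp

/-- A lower bound for trigonometric sums by duality: if each frequency `s` of `S` is singled out by
a function supported in `[-A, A]` whose symbol decays away from `s`, summably and uniformly, then
the `ℓ²` norm of the coefficients is controlled by the `L²` norm on `[-A, A]`. -/
theorem sum_sq_le_of_biorthogonal {A : ℝ} (hA0 : 0 < A) (hA : A < Real.pi) {ρ : ℤ → ℝ}
    (hρ : Summable ρ) (h0 : ∀ k, 0 ≤ ρ k) {S : Finset ℤ}
    (hS : ∀ s ∈ S, ∃ g : ℤ → ℂ, IsSymbol A g ∧ g s = 1 ∧ (∀ t ∈ S, t ≠ s → g t = 0) ∧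
      ∀ k, ‖g k‖ ≤ ρ (k - s)) (c : ℤ → ℂ) :
    ∑ s ∈ S, ‖c s‖ ^ 2 ≤ ((∑' k, ρ k) ^ 2 + 1) *
      ∫ y in (-A)..A, ‖∑ s ∈ S, c s * wave s y‖ ^ 2 := by
  classical
  have hS' : ∀ s, ∃ g : ℤ → ℂ, s ∈ S → IsSymbol A g ∧ g s = 1 ∧
      (∀ t ∈ S, t ≠ s → g t = 0) ∧ ∀ k, ‖g k‖ ≤ ρ (k - s) := by
    intro s
    by_cases hs : s ∈ S
    · obtain ⟨g, hg⟩ := hS s hs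
      exact ⟨g, fun _ => hg⟩
    · exact ⟨0, fun h => absurd h hs⟩
  choose g hg using hS'
  obtain ⟨F, hFc, hFs, hFi⟩ := IsSymbol.sum S (fun s => (starRingEnd ℂ) (c s)) fun s hs => (hg s hs).1
  set R := ∑' k, ρ k with hR
  have hR0 : 0 ≤ R := tsum_nonneg h0
  set X := ∑ s ∈ S, ‖c s‖ ^ 2 with hX
  have hX0 : 0 ≤ X := Finset.sum_nonneg fun s _ => by positivity
  set f : ℝ → ℂ := fun y => ∑ s ∈ S, c s * wave s y with hf
  have hfc : Continuous f :=
    continuous_finsetSum _ fun s _ => continuous_const.mul (continuous_wave s)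
  -- Young's inequality on the Fourier side
  have hpt : ∀ k, ‖∫ y, F y * wave k y‖ ^ 2 ≤ R * ∑ s ∈ S, ‖c s‖ ^ 2 * ρ (k - s) := by
    intro k
    rw [← hFi]
    have h1 : ‖∑ s ∈ S, (starRingEnd ℂ) (c s) * g s k‖ ≤ ∑ s ∈ S, ‖c s‖ * ρ (k - s) := by
      refine (norm_sum_le _ _).trans (Finset.sum_le_sum fun s hs => ?_)
      rw [norm_mul, RCLike.norm_conj]
      gcongr
      exact (hg s hs).2.2.2 k
    calc ‖∑ s ∈ S, (starRingEnd ℂ) (c s) * g s k‖ ^ 2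
        ≤ (∑ s ∈ S, ‖c s‖ * ρ (k - s)) ^ 2 := by gcongr
      _ ≤ (∑ s ∈ S, ρ (k - s)) * ∑ s ∈ S, ‖c s‖ ^ 2 * ρ (k - s) :=
          Finset.sum_sq_le_sum_mul_sum_of_sq_le_mul S (fun s _ => h0 _)
            (fun s _ => mul_nonneg (sq_nonneg _) (h0 _)) (fun s _ => le_of_eq (by ring))
      _ ≤ R * ∑ s ∈ S, ‖c s‖ ^ 2 * ρ (k - s) := by
          gcongr
          · exact Finset.sum_nonneg fun s _ => mul_nonneg (sq_nonneg _) (h0 _)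
          · exact sum_comp_le_tsum hρ h0 S sub_right_injective
  have hF2 : 2 * Real.pi * ∫ y, ‖F y‖ ^ 2 ≤ R ^ 2 * X := by
    refine hasSum_le_of_sum_le (hasSum_sq_symbol hA hFc hFs) fun K => ?_
    calc ∑ k ∈ K, ‖∫ y, F y * wave (-k) y‖ ^ 2
        ≤ ∑ k ∈ K, R * ∑ s ∈ S, ‖c s‖ ^ 2 * ρ (-k - s) := Finset.sum_le_sum fun k _ => hpt (-k)
      _ = R * ∑ s ∈ S, ‖c s‖ ^ 2 * ∑ k ∈ K, ρ (-k - s) := by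
          rw [← Finset.mul_sum, Finset.sum_comm]
          simp_rw [Finset.mul_sum]
      _ ≤ R * ∑ s ∈ S, ‖c s‖ ^ 2 * R := by
          gcongr with s hs
          exact sum_comp_le_tsum hρ h0 K fun k k' h => by simpa using h
      _ = R ^ 2 * X := by rw [← Finset.sum_mul]; ring
  have hduality : ∫ y in (-A)..A, F y * f y = (X : ℂ) := by
    have h1 : ∫ y in (-A)..A, F y * f y = ∫ y, F y * f y := by
      rw [intervalIntegral.integral_of_le (by linarith), ← integral_Icc_eq_integral_Ioc]
      refine setIntegral_eq_integral_of_forall_compl_eq_zero fun y hy => ?_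
      rw [hFs y, zero_mul]
      by_contra h
      exact hy (abs_le.mp (not_lt.mp h))
    have h2 : ∀ y, F y * f y = ∑ s ∈ S, c s * (F y * wave s y) := by
      intro y
      rw [hf, Finset.mul_sum]
      exact Finset.sum_congr rfl fun s _ => by ring
    rw [h1]
    simp_rw [h2]
    rw [integral_finsetSum _ fun s _ => (integrable_mul_wave hFc hFs s).const_mul _, hX]
    push_cast
    refine Finset.sum_congr rfl fun t ht => ?_
    rw [integral_const_mul, ← hFi]
    beta_reduce
    rw [Finset.sum_eq_single t, (hg t ht).2.1, mul_one,
      Complex.mul_conj, Complex.normSq_eq_norm_sq]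
    · push_cast; rfl
    · intro s hs hst
      rw [(hg s hs).2.2.1 t ht (Ne.symm hst), mul_zero]
    · exact fun h => absurd ht h
  set Q := R ^ 2 + 1 with hQ
  have hQ0 : 0 < Q := by positivity
  -- the inequality of arithmetic and geometric means; `Q` is such that the term in `F` is absorbed
  have hXle : X ≤ (1 / (2 * Q)) * (∫ y, ‖F y‖ ^ 2) + Q / 2 * ∫ y in (-A)..A, ‖f y‖ ^ 2 := by
    have hF2c : Continuous fun y => ‖F y‖ ^ 2 := by fun_prop
    have hf2c : Continuous fun y => ‖f y‖ ^ 2 := by fun_prop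
    calc X = ‖∫ y in (-A)..A, F y * f y‖ := by
          rw [hduality, Complex.norm_real, Real.norm_eq_abs, abs_of_nonneg hX0]
      _ ≤ ∫ y in (-A)..A, ‖F y * f y‖ :=
          intervalIntegral.norm_integral_le_integral_norm (by linarith)
      _ ≤ ∫ y in (-A)..A, ((1 / (2 * Q)) * ‖F y‖ ^ 2 + Q / 2 * ‖f y‖ ^ 2) := by
          refine intervalIntegral.integral_mono_on (by linarith)
            ((by fun_prop : Continuous fun y => ‖F y * f y‖).intervalIntegrable _ _)
            ((by fun_prop : Continuous fun y =>
              (1 / (2 * Q)) * ‖F y‖ ^ 2 + Q / 2 * ‖f y‖ ^ 2).intervalIntegrable _ _) fun y _ => ?_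
          rw [norm_mul]
          rw [← sub_nonneg]
          have h3 : (1 / (2 * Q)) * ‖F y‖ ^ 2 + Q / 2 * ‖f y‖ ^ 2 - ‖F y‖ * ‖f y‖ =
              (1 / (2 * Q)) * (‖F y‖ - Q * ‖f y‖) ^ 2 := by
            field_simp; ring
          rw [h3]
          positivity
      _ = (1 / (2 * Q)) * (∫ y in (-A)..A, ‖F y‖ ^ 2) + Q / 2 * ∫ y in (-A)..A, ‖f y‖ ^ 2 := by
          rw [intervalIntegral.integral_add, intervalIntegral.integral_const_mul,
            intervalIntegral.integral_const_mul]
          · exact (hF2c.intervalIntegrable _ _).const_mul _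
          · exact (hf2c.intervalIntegrable _ _).const_mul _
      _ = _ := by
          congr 2
          rw [intervalIntegral.integral_of_le (by linarith), ← integral_Icc_eq_integral_Ioc]
          refine setIntegral_eq_integral_of_forall_compl_eq_zero fun y hy => ?_
          rw [hFs y, norm_zero, zero_pow two_ne_zero]
          by_contra h
          exact hy (abs_le.mp (not_lt.mp h))
  have hF3 : (1 / (2 * Q)) * (∫ y, ‖F y‖ ^ 2) ≤ X / 2 := by
    have hI : 0 ≤ ∫ y, ‖F y‖ ^ 2 := integral_nonneg fun y => by positivity
    have h1 : ∫ y, ‖F y‖ ^ 2 ≤ Q * X := by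
      nlinarith [Real.pi_gt_three]
    calc (1 / (2 * Q)) * (∫ y, ‖F y‖ ^ 2) ≤ (1 / (2 * Q)) * (Q * X) := by gcongr
      _ = X / 2 := by field_simp
  linarith

/-- Trigonometric sums whose frequencies are abscissae of lattice points of one circle are
observable on every interval, with a constant that does not depend on the circle. -/
theorem exists_sum_sq_le_integral_of_circle {A : ℝ} (hA0 : 0 < A) (hA : A < Real.pi) :
    ∃ K : ℝ, 0 < K ∧ ∀ (M : ℤ) (S : Finset ℤ), (∀ x ∈ S, ∃ n : ℤ, x ^ 2 + n ^ 2 = M) →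
      ∀ (c : ℤ → ℂ) (x₀ : ℝ), ∑ s ∈ S, ‖c s‖ ^ 2 ≤
        K * ∫ y in (x₀ - A)..(x₀ + A), ‖∑ s ∈ S, c s * wave s y‖ ^ 2 := by
  classical
  set κ : ℝ := Real.sqrt (32 * ∑' j : ℤ, 1 / (j : ℝ) ^ 2) + 1 with hκ
  have hκ0 : 0 < κ := by positivity
  have hε : 0 < A / (2 * (κ + 2)) := by positivity
  obtain ⟨L, r, hL, hr, hrL, hwin⟩ := exists_window_card_lattice_abscissae_le hε
  have hLR : (0 : ℝ) < L := by exact_mod_cast hL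
  have haL : 32 * (∑' j : ℤ, 1 / (j : ℝ) ^ 2) ≤ (κ / L) ^ 2 * (L : ℝ) ^ 2 := by
    have h1 : (0 : ℝ) ≤ 32 * ∑' j : ℤ, 1 / (j : ℝ) ^ 2 :=
      mul_nonneg (by norm_num) (tsum_nonneg fun j => by positivity)
    have h2 := Real.sq_sqrt h1
    have h3 := Real.sqrt_nonneg (32 * ∑' j : ℤ, 1 / (j : ℝ) ^ 2)
    rw [← mul_pow, div_mul_cancel₀ _ hLR.ne', hκ]
    nlinarith
  obtain ⟨ρ, hρ, hρ0, hsym⟩ := exists_symbol_of_window hL hr (div_pos hκ0 hLR) haL (half_pos hA0)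
  have hA' : A / 2 + r * (κ / L) + 2 * r * (1 / L) ≤ A := by
    have h1 : (r : ℝ) / L ≤ A / (2 * (κ + 2)) := by rwa [div_le_iff₀ hLR]
    have h2 : (r : ℝ) / L * (κ + 2) ≤ A / (2 * (κ + 2)) * (κ + 2) := by gcongr
    have h3 : A / (2 * (κ + 2)) * (κ + 2) = A / 2 := by field_simp
    have h4 : A / 2 + r * (κ / L) + 2 * r * (1 / L) = A / 2 + (r : ℝ) / L * (κ + 2) := by
      field_simp
      ring
    linarith
  refine ⟨(∑' k, ρ k) ^ 2 + 1, by positivity, fun M S hS c x₀ => ?_⟩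
  have hbi : ∀ s ∈ S, ∃ g : ℤ → ℂ, IsSymbol A g ∧ g s = 1 ∧ (∀ t ∈ S, t ≠ s → g t = 0) ∧
      ∀ k, ‖g k‖ ≤ ρ (k - s) := by
    intro s hs
    obtain ⟨g, hg, hg0, hgz, hgb⟩ := hsym (S.image fun t => t - s)
      (Finset.mem_image.mpr ⟨s, hs, sub_self s⟩) (by
        intro z
        have hinj : Function.Injective fun t : ℤ => t + s := add_left_injective s
        rw [← Finset.card_image_of_injective _ hinj]
        refine hwin M (z + s) _ fun x hx => ?_
        obtain ⟨t, ht, rfl⟩ := Finset.mem_image.mp hx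
        obtain ⟨ht, hz1, hz2⟩ := Finset.mem_filter.mp ht
        obtain ⟨u, hu, rfl⟩ := Finset.mem_image.mp ht
        refine ⟨by linarith, by linarith, ?_⟩
        simpa using hS u hu)
    refine ⟨fun k => g (k - s), (hg.mono hA').translate s, by simpa using hg0, ?_, fun k => hgb _⟩
    intro t ht hts
    exact hgz _ (Finset.mem_image.mpr ⟨t, ht, rfl⟩) (sub_ne_zero.mpr hts)
  have h := sum_sq_le_of_biorthogonal hA0 hA hρ hρ0 hbi fun s => c s * wave s x₀
  simp only [norm_mul, norm_wave, mul_one] at h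
  refine h.trans (le_of_eq ?_)
  congr 1
  have := intervalIntegral.integral_comp_add_left
    (fun y => ‖∑ s ∈ S, c s * wave s y‖ ^ 2) x₀ (a := -A) (b := A)
  rw [← sub_eq_add_neg] at this
  rw [← this]
  simp only [wave_add_right, mul_assoc]

/-! ### Sums of sines and cosines -/

/-- The sum `∑ c k sin (m k y)` is a sum of exponentials over the pairs of an index and a sign. -/
theorem sum_sin_eq_sum_wave {ι : Type*} (Q : Finset ι) (m : ι → ℕ+) (c : ι → ℂ) (y : ℝ) :
    ∑ k ∈ Q, c k * (Real.sin ((m k : ℕ) * y) : ℂ) =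
      ∑ t ∈ Q ×ˢ (Finset.univ : Finset Bool),
        (cond t.2 (-Complex.I) Complex.I * c t.1 / 2) * wave (cond t.2 1 (-1) * (m t.1 : ℤ)) y := by
  rw [Finset.sum_product]
  refine Finset.sum_congr rfl fun k _ => ?_
  rw [Fintype.sum_bool]
  simp only [cond_true, cond_false, wave, Complex.ofReal_sin, Complex.sin]
  push_cast
  ring_nf

theorem sum_cos_eq_sum_wave {ι : Type*} (Q : Finset ι) (m : ι → ℕ+) (c : ι → ℂ) (y : ℝ) :
    ∑ k ∈ Q, c k * (Real.cos ((m k : ℕ) * y) : ℂ) =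
      ∑ t ∈ Q ×ˢ (Finset.univ : Finset Bool),
        (c t.1 / 2) * wave (cond t.2 1 (-1) * (m t.1 : ℤ)) y := by
  rw [Finset.sum_product]
  refine Finset.sum_congr rfl fun k _ => ?_
  rw [Fintype.sum_bool]
  simp only [cond_true, cond_false, wave, Complex.ofReal_cos, Complex.cos]
  push_cast
  ring_nf

theorem injOn_signed {ι : Type*} {Q : Finset ι} {m : ι → ℕ+} (hm : Set.InjOn m Q) :
    Set.InjOn (fun t : ι × Bool => cond t.2 1 (-1) * (m t.1 : ℤ))
      (Q ×ˢ (Finset.univ : Finset Bool) : Finset (ι × Bool)) := by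
  rintro ⟨k, b⟩ hk ⟨l, b'⟩ hl h
  have hkQ : k ∈ Q := (Finset.mem_product.mp hk).1
  have hlQ : l ∈ Q := (Finset.mem_product.mp hl).1
  have h1 : (0 : ℤ) < (m k : ℕ) := by exact_mod_cast (m k).pos
  have h2 : (0 : ℤ) < (m l : ℕ) := by exact_mod_cast (m l).pos
  have key : ((m k : ℕ) : ℤ) = (m l : ℕ) → k = l := fun h => hm hkQ hlQ (by
    apply PNat.coe_injective; exact_mod_cast h)
  cases b <;> cases b' <;> simp only [cond_true, cond_false] at h
  · rw [key (by linarith)]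
  · linarith
  · linarith
  · rw [key (by linarith)]

theorem exists_extend_coeff {τ : Type*} {T : Finset τ} {σ : τ → ℤ} (hσ : Set.InjOn σ T)
    (c : τ → ℂ) : ∃ C : ℤ → ℂ, ∀ t ∈ T, C (σ t) = c t := by
  classical
  refine ⟨fun s => if h : ∃ t ∈ T, σ t = s then c h.choose else 0, fun t ht => ?_⟩
  have h : ∃ t' ∈ T, σ t' = σ t := ⟨t, ht, rfl⟩
  beta_reduce
  rw [dif_pos h, hσ h.choose_spec.1 ht h.choose_spec.2]

/-- Sums of sines whose frequencies are abscissae of lattice points of one circle are observable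
on every interval, with a constant that does not depend on the circle. -/
theorem exists_sum_sq_le_integral_sin {A : ℝ} (hA0 : 0 < A) (hA : A < Real.pi) :
    ∃ K : ℝ, 0 < K ∧ ∀ {ι : Type} (Q : Finset ι) (m n : ι → ℕ+) (M : ℤ), Set.InjOn m Q →
      (∀ k ∈ Q, ((m k : ℕ) : ℤ) ^ 2 + ((n k : ℕ) : ℤ) ^ 2 = M) →
      ∀ (c : ι → ℂ) (x₀ : ℝ), ∑ k ∈ Q, ‖c k‖ ^ 2 ≤
        K * ∫ y in (x₀ - A)..(x₀ + A), ‖∑ k ∈ Q, c k * (Real.sin ((m k : ℕ) * y) : ℂ)‖ ^ 2 := by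
  classical
  obtain ⟨K, hK, h⟩ := exists_sum_sq_le_integral_of_circle hA0 hA
  refine ⟨2 * K, by positivity, fun {ι} Q m n M hm hcircle c x₀ => ?_⟩
  set T := Q ×ˢ (Finset.univ : Finset Bool)
  set σ : ι × Bool → ℤ := fun t => cond t.2 1 (-1) * (m t.1 : ℤ) with hσ
  have hinj : Set.InjOn σ T := injOn_signed hm
  obtain ⟨C, hC⟩ := exists_extend_coeff hinj
    fun t => cond t.2 (-Complex.I) Complex.I * c t.1 / 2
  have h1 := h M (T.image σ) (by
    intro x hx
    obtain ⟨⟨k, b⟩, ht, rfl⟩ := Finset.mem_image.mp hx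
    refine ⟨(n k : ℕ), ?_⟩
    rw [← hcircle k (Finset.mem_product.mp ht).1]
    cases b <;> simp [hσ]) C x₀
  rw [Finset.sum_image hinj] at h1
  have h2 : ∀ y, ∑ s ∈ T.image σ, C s * wave s y =
      ∑ k ∈ Q, c k * (Real.sin ((m k : ℕ) * y) : ℂ) := by
    intro y
    rw [sum_sin_eq_sum_wave, Finset.sum_image hinj]
    exact Finset.sum_congr rfl fun t ht => by rw [hC t ht]
  have h3 : ∑ t ∈ T, ‖C (σ t)‖ ^ 2 = (1 / 2) * ∑ k ∈ Q, ‖c k‖ ^ 2 := by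
    rw [Finset.sum_congr rfl fun t ht => by rw [hC t ht], Finset.sum_product, Finset.mul_sum]
    refine Finset.sum_congr rfl fun k _ => ?_
    simp
    ring
  simp_rw [h2] at h1
  rw [h3] at h1
  linarith

theorem integral_wave (k : ℤ) :
    ∫ y in (-Real.pi)..Real.pi, wave k y = if k = 0 then (2 * Real.pi : ℂ) else 0 := by
  split_ifs with hk
  · subst hk
    simp only [wave_zero]
    rw [intervalIntegral.integral_const]
    simp
    ring
  · have hkC : Complex.I * k ≠ 0 := mul_ne_zero Complex.I_ne_zero (by exact_mod_cast hk)
    have h1 : ∫ y in (-Real.pi)..Real.pi, Complex.I * k * wave k y = 0 := by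
      rw [intervalIntegral.integral_eq_sub_of_hasDerivAt (fun y _ => hasDerivAt_wave k y)
        ((continuous_const.mul (continuous_wave k)).intervalIntegrable _ _)]
      have h2 : wave k (2 * Real.pi) = 1 := by
        rw [wave, Complex.exp_eq_one_iff]
        exact ⟨k, by push_cast; ring⟩
      have h3 : wave k Real.pi = wave k (2 * Real.pi) * wave k (-Real.pi) := by
        rw [← wave_add_right]; congr 1; ring
      rw [h3, h2, one_mul, sub_self]
    rw [intervalIntegral.integral_const_mul] at h1
    exact (mul_eq_zero.mp h1).resolve_left hkC

/-- Orthogonality of the exponentials, for a family with distinct frequencies. -/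
theorem integral_norm_sq_sum_wave {τ : Type*} {T : Finset τ} {σ : τ → ℤ} (hσ : Set.InjOn σ T)
    (c : τ → ℂ) :
    ∫ y in (-Real.pi)..Real.pi, ‖∑ t ∈ T, c t * wave (σ t) y‖ ^ 2 =
      2 * Real.pi * ∑ t ∈ T, ‖c t‖ ^ 2 := by
  have hconj : ∀ (k : ℤ) (y : ℝ), (starRingEnd ℂ) (wave k y) = wave (-k) y := by
    intro k y
    rw [wave, wave, ← Complex.exp_conj]
    congr 1
    simp
  have hpt : ∀ y : ℝ, ((‖∑ t ∈ T, c t * wave (σ t) y‖ ^ 2 : ℝ) : ℂ) =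
      ∑ s ∈ T, ∑ t ∈ T, c s * (starRingEnd ℂ) (c t) * wave (σ s - σ t) y := by
    intro y
    rw [← Complex.normSq_eq_norm_sq, ← Complex.mul_conj, map_sum, Finset.sum_mul_sum]
    refine Finset.sum_congr rfl fun s _ => Finset.sum_congr rfl fun t _ => ?_
    rw [map_mul, hconj, sub_eq_add_neg, wave_add_left]
    ring
  have hint : ∀ s t : τ, IntervalIntegrable
      (fun y => c s * (starRingEnd ℂ) (c t) * wave (σ s - σ t) y) volume (-Real.pi) Real.pi :=
    fun s t => (continuous_const.mul (continuous_wave _)).intervalIntegrable _ _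
  have h : ((∫ y in (-Real.pi)..Real.pi, ‖∑ t ∈ T, c t * wave (σ t) y‖ ^ 2 : ℝ) : ℂ) =
      ((2 * Real.pi * ∑ t ∈ T, ‖c t‖ ^ 2 : ℝ) : ℂ) := by
    rw [← intervalIntegral.integral_ofReal]
    simp_rw [hpt]
    have hint' : ∀ s ∈ T, IntervalIntegrable
        (fun y => ∑ t ∈ T, c s * (starRingEnd ℂ) (c t) * wave (σ s - σ t) y)
        volume (-Real.pi) Real.pi := fun s _ =>
      (continuous_finsetSum _ fun t _ =>
        continuous_const.mul (continuous_wave _)).intervalIntegrable _ _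
    rw [intervalIntegral.integral_finsetSum hint']
    simp_rw [intervalIntegral.integral_finsetSum fun t _ => hint _ t,
      intervalIntegral.integral_const_mul, integral_wave]
    push_cast
    rw [Finset.mul_sum]
    refine Finset.sum_congr rfl fun s hs => ?_
    rw [Finset.sum_eq_single s]
    · rw [sub_self, if_pos rfl, Complex.mul_conj, Complex.normSq_eq_norm_sq]
      push_cast; ring
    · intro t ht hts
      rw [if_neg (sub_ne_zero.mpr fun h => hts (hσ ht hs h.symm)), mul_zero]
    · exact fun h => absurd hs h
  exact_mod_cast h

theorem setIntegral_norm_sq_sum_wave_le {τ : Type*} {T : Finset τ} {σ : τ → ℤ}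
    (hσ : Set.InjOn σ T) (c : τ → ℂ) :
    ∫ y in Set.Ioo 0 Real.pi, ‖∑ t ∈ T, c t * wave (σ t) y‖ ^ 2 ≤
      2 * Real.pi * ∑ t ∈ T, ‖c t‖ ^ 2 := by
  have hpi := Real.pi_pos
  rw [← integral_norm_sq_sum_wave hσ, intervalIntegral.integral_of_le (by linarith)]
  have hc : Continuous fun y => ‖∑ t ∈ T, c t * wave (σ t) y‖ ^ 2 :=
    (continuous_finsetSum _ fun t _ => continuous_const.mul (continuous_wave _)).norm.pow 2
  refine setIntegral_mono_set (hc.integrableOn_Ioc) (Filter.Eventually.of_forall fun y => ?_)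
    (Filter.Eventually.of_forall fun y hy => ?_)
  · exact sq_nonneg _
  · exact ⟨by linarith [hy.1], hy.2.le⟩

theorem setIntegral_norm_sq_sum_sin_le {ι : Type*} {Q : Finset ι} {m : ι → ℕ+}
    (hm : Set.InjOn m Q) (c : ι → ℂ) :
    ∫ y in Set.Ioo 0 Real.pi, ‖∑ k ∈ Q, c k * (Real.sin ((m k : ℕ) * y) : ℂ)‖ ^ 2 ≤
      Real.pi * ∑ k ∈ Q, ‖c k‖ ^ 2 := by
  simp_rw [sum_sin_eq_sum_wave]
  refine (setIntegral_norm_sq_sum_wave_le (injOn_signed hm) _).trans (le_of_eq ?_)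
  rw [Finset.sum_product, mul_assoc, Finset.mul_sum, Finset.mul_sum, Finset.mul_sum]
  refine Finset.sum_congr rfl fun k _ => ?_
  simp
  ring

theorem setIntegral_norm_sq_sum_cos_le {ι : Type*} {Q : Finset ι} {m : ι → ℕ+}
    (hm : Set.InjOn m Q) (c : ι → ℂ) :
    ∫ y in Set.Ioo 0 Real.pi, ‖∑ k ∈ Q, c k * (Real.cos ((m k : ℕ) * y) : ℂ)‖ ^ 2 ≤
      Real.pi * ∑ k ∈ Q, ‖c k‖ ^ 2 := by
  simp_rw [sum_cos_eq_sum_wave]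
  refine (setIntegral_norm_sq_sum_wave_le (injOn_signed hm) _).trans (le_of_eq ?_)
  rw [Finset.sum_product, mul_assoc, Finset.mul_sum, Finset.mul_sum, Finset.mul_sum]
  refine Finset.sum_congr rfl fun k _ => ?_
  simp
  ring

/-! ### Combinations of eigenfunctions -/

/-- The frequency of the eigenfunction of index `k` in the direction of the coordinate `i`. -/
def frequency (k : ℕ+ × ℕ+) (i : Fin 2) : ℕ+ := if i = 0 then k.2 else k.1

/-- The constant that normalizes the eigenfunction of index `k`. -/
noncomputable def amplitude (k : ℕ+ × ℕ+) : ℝ := 2 / (Real.pi * Real.sqrt (eigenvalue k))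

theorem eigenvalue_pos (k : ℕ+ × ℕ+) : 0 < eigenvalue k := by
  have h1 : (0 : ℝ) < ((k.1 : ℕ) : ℝ) := by exact_mod_cast k.1.pos
  have h2 : (0 : ℝ) < ((k.2 : ℕ) : ℝ) := by exact_mod_cast k.2.pos
  unfold eigenvalue
  positivity

theorem amplitude_sq (k : ℕ+ × ℕ+) : amplitude k ^ 2 = 4 / (Real.pi ^ 2 * eigenvalue k) := by
  rw [amplitude, div_pow, mul_pow, Real.sq_sqrt (eigenvalue_pos k).le]
  norm_num

theorem eigenfunction_eq (k : ℕ+ × ℕ+) (i : Fin 2) (x : Plane) :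
    eigenfunction k x = ((amplitude k * Real.sin ((frequency k i : ℕ) * x i) *
      Real.sin ((frequency k (i + 1) : ℕ) * x (i + 1)) : ℝ) : ℂ) := by
  revert i
  rw [Fin.forall_fin_two]
  constructor
  · simp [eigenfunction, amplitude, frequency]
  · have h : (1 : Fin 2) + 1 = 0 := rfl
    simp only [eigenfunction, amplitude, frequency, h, if_pos, if_neg one_ne_zero]
    push_cast
    ring

theorem add_one_ne_self_fin_two (i : Fin 2) : i + 1 ≠ i := by revert i; decide

/-- The linear combination of eigenfunctions with indices in a finite set. -/
noncomputable def combination (Q : Finset (ℕ+ × ℕ+)) (a : ℕ+ × ℕ+ → ℂ) (x : Plane) : ℂ :=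
  ∑ k ∈ Q, a k * eigenfunction k x

/-- The partial derivative of `combination Q a` in the direction of the coordinate `i`, at the point
whose coordinate `i` is `s` and whose other coordinate is `t`. In `Fin 2`, `i + 1` is the index of
the other coordinate. -/
noncomputable def partialCombination (Q : Finset (ℕ+ × ℕ+)) (a : ℕ+ × ℕ+ → ℂ) (i : Fin 2)
    (s t : ℝ) : ℂ :=
  ∑ k ∈ Q, a k * ((amplitude k * ((frequency k i : ℕ) * Real.cos ((frequency k i : ℕ) * s)) *
    Real.sin ((frequency k (i + 1) : ℕ) * t) : ℝ) : ℂ)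

theorem continuous_partialCombination (Q : Finset (ℕ+ × ℕ+)) (a : ℕ+ × ℕ+ → ℂ) (i : Fin 2) :
    Continuous fun p : ℝ × ℝ => partialCombination Q a i p.1 p.2 := by
  unfold partialCombination
  fun_prop

theorem differentiable_combination (Q : Finset (ℕ+ × ℕ+)) (a : ℕ+ × ℕ+ → ℂ) :
    Differentiable ℝ (combination Q a) := by
  unfold combination eigenfunction
  refine Differentiable.fun_sum fun k _ => Differentiable.const_mul ?_ _
  have h : Differentiable ℝ fun x : Plane => 2 / (Real.pi * Real.sqrt (eigenvalue k))
      * Real.sin (((k.2 : ℕ) : ℝ) * x 0) * Real.sin (((k.1 : ℕ) : ℝ) * x 1) := by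
    fun_prop
  exact Complex.ofRealCLM.differentiable.comp h

theorem fderiv_combination (Q : Finset (ℕ+ × ℕ+)) (a : ℕ+ × ℕ+ → ℂ) (i : Fin 2) (x : Plane) :
    fderiv ℝ (combination Q a) x (EuclideanSpace.single i 1) =
      partialCombination Q a i (x i) (x (i + 1)) := by
  rw [← (differentiable_combination Q a x).lineDeriv_eq_fderiv]
  have hne := add_one_ne_self_fin_two i
  have h : HasLineDerivAt ℝ (combination Q a) (partialCombination Q a i (x i) (x (i + 1))) x
      (EuclideanSpace.single i 1) := by
    unfold HasLineDerivAt
    have hfun : (fun t : ℝ => combination Q a (x + t • (EuclideanSpace.single i 1 : Plane))) =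
        fun t : ℝ => ∑ k ∈ Q, a k * ((amplitude k * Real.sin ((frequency k i : ℕ) * (x i + t)) *
          Real.sin ((frequency k (i + 1) : ℕ) * x (i + 1)) : ℝ) : ℂ) := by
      ext t
      unfold combination
      refine Finset.sum_congr rfl fun k _ => ?_
      rw [eigenfunction_eq k i]
      simp [hne]
    rw [hfun]
    refine HasDerivAt.fun_sum fun k _ => HasDerivAt.const_mul _ (HasDerivAt.ofReal_comp ?_)
    have h1 : HasDerivAt (fun t : ℝ => ((frequency k i : ℕ) : ℝ) * (x i + t))
        (frequency k i : ℕ) 0 := by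
      simpa using ((hasDerivAt_id (0 : ℝ)).const_add (x i)).const_mul ((frequency k i : ℕ) : ℝ)
    have h2 := ((h1.sin.const_mul (amplitude k)).mul_const
      (Real.sin ((frequency k (i + 1) : ℕ) * x (i + 1))))
    refine h2.congr_deriv ?_
    rw [add_zero]
    ring
  exact h.lineDeriv

/-! ### Geometry of the square -/

/-- The point with coordinate `i` equal to `c` and the other one equal to `t`. -/
def sidePoint (i : Fin 2) (c t : ℝ) : Plane := WithLp.toLp 2 fun j => if j = i then c else t

theorem sidePoint_self (i : Fin 2) (c t : ℝ) : sidePoint i c t i = c := by simp [sidePoint]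

theorem sidePoint_of_ne {i j : Fin 2} (h : j ≠ i) (c t : ℝ) : sidePoint i c t j = t := by
  simp [sidePoint, h]

theorem sidePoint_add_one (i : Fin 2) (c t : ℝ) : sidePoint i c t (i + 1) = t :=
  sidePoint_of_ne (add_one_ne_self_fin_two i) c t

theorem eq_sidePoint {i : Fin 2} {c : ℝ} {x : Plane} (hx : x i = c) :
    x = sidePoint i c (x (i + 1)) := by
  ext j
  by_cases h : j = i
  · rw [h, sidePoint_self, hx]
  · rw [sidePoint_of_ne h]
    have h2 : ∀ i j : Fin 2, j ≠ i → j = i + 1 := by decide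
    rw [h2 i j h]

theorem isometry_sidePoint (i : Fin 2) (c : ℝ) : Isometry (sidePoint i c) := by
  refine Isometry.of_dist_eq fun s t => ?_
  rw [EuclideanSpace.dist_eq, Fin.sum_univ_two]
  have h : ∀ i : Fin 2, dist (sidePoint i c s 0) (sidePoint i c t 0) ^ 2 +
      dist (sidePoint i c s 1) (sidePoint i c t 1) ^ 2 = dist s t ^ 2 := by
    rw [Fin.forall_fin_two]
    constructor <;> simp [sidePoint]
  rw [h, Real.sqrt_sq dist_nonneg]

theorem square_eq_preimage :
    square = (EuclideanSpace.equiv (Fin 2) ℝ) ⁻¹' Set.univ.pi fun _ => Set.Ioo 0 Real.pi := by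
  ext x
  simp [square]

theorem isOpen_square : IsOpen square := by
  rw [square_eq_preimage]
  exact (isOpen_set_pi Set.finite_univ fun _ _ => isOpen_Ioo).preimage
    (EuclideanSpace.equiv (Fin 2) ℝ).continuous

theorem mem_closure_square {x : Plane} : x ∈ closure square ↔ ∀ i, x i ∈ Set.Icc 0 Real.pi := by
  rw [square_eq_preimage, ← ContinuousLinearEquiv.preimage_closure, closure_pi_set,
    closure_Ioo Real.pi_pos.ne]
  simp only [Set.mem_preimage, Set.mem_pi, Set.mem_univ, true_imp_iff]
  rfl

theorem mem_frontier_square {x : Plane} :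
    x ∈ frontier square ↔ (∀ i, x i ∈ Set.Icc 0 Real.pi) ∧ ¬ ∀ i, x i ∈ Set.Ioo 0 Real.pi := by
  rw [isOpen_square.frontier_eq, Set.mem_sdiff, mem_closure_square]
  rfl

theorem convex_square : Convex ℝ square := by
  rw [square_eq_preimage]
  exact (convex_pi fun _ _ => convex_Ioo _ _).linear_preimage
    (EuclideanSpace.equiv (Fin 2) ℝ).toLinearMap

theorem square_nonempty : square.Nonempty :=
  ⟨WithLp.toLp 2 fun _ => Real.pi / 2, fun _ =>
    ⟨by simpa using Real.pi_pos, by simpa using half_lt_self Real.pi_pos⟩⟩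

theorem uniqueDiffOn_closure_square : UniqueDiffOn ℝ (closure square) := by
  refine uniqueDiffOn_convex convex_square.closure (square_nonempty.mono ?_)
  exact interior_maximal subset_closure isOpen_square

/-- At a point of a side that is not a corner the normal is a coordinate vector. -/
theorem outwardNormal_sidePoint {i : Fin 2} {c t : ℝ} (hc : c = 0 ∨ c = Real.pi)
    (ht : t ∈ Set.Ioo 0 Real.pi) :
    outwardNormal (sidePoint i c t) = EuclideanSpace.single i 1 ∨
      outwardNormal (sidePoint i c t) = -EuclideanSpace.single i 1 := by
  have hpi := Real.pi_pos.ne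
  revert i
  rw [Fin.forall_fin_two]
  constructor
  · rcases hc with rfl | rfl <;> simp [outwardNormal, sidePoint, hpi.symm]
  · rcases hc with rfl | rfl <;>
      simp [outwardNormal, sidePoint, hpi.symm, ht.1.ne', ht.2.ne]

theorem norm_normalDerivative_combination (Q : Finset (ℕ+ × ℕ+)) (a : ℕ+ × ℕ+ → ℂ) {i : Fin 2}
    {c t : ℝ} (hc : c = 0 ∨ c = Real.pi) (ht : t ∈ Set.Ioo 0 Real.pi) :
    ‖normalDerivative (combination Q a) (sidePoint i c t)‖ = ‖partialCombination Q a i c t‖ := by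
  have hmem : sidePoint i c t ∈ closure square := by
    refine mem_closure_square.mpr fun j => ?_
    by_cases h : j = i
    · rw [h, sidePoint_self]
      rcases hc with rfl | rfl
      · exact ⟨le_rfl, Real.pi_pos.le⟩
      · exact ⟨Real.pi_pos.le, le_rfl⟩
    · rw [sidePoint_of_ne h]
      exact ⟨ht.1.le, ht.2.le⟩
  have h := fderiv_combination Q a i (sidePoint i c t)
  rw [sidePoint_self, sidePoint_add_one] at h
  rw [normalDerivative, (differentiable_combination Q a _).fderivWithin
    (uniqueDiffOn_closure_square _ hmem)]
  rcases outwardNormal_sidePoint (i := i) hc ht with h' | h' <;> rw [h']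
  · rw [h]
  · rw [map_neg, norm_neg, h]

/-! ### The observation on a side -/

/-- An observation set lies on one side, and contains a segment that stays away from the corners. -/
theorem IsOneSidedObservationSet.exists_interval {Γ : Set Plane}
    (hΓ : IsOneSidedObservationSet Γ) : ∃ (i : Fin 2) (c : ℝ), (c = 0 ∨ c = Real.pi) ∧
      Γ ⊆ sidePoint i c '' Set.Icc 0 Real.pi ∧ ∃ x₀ A : ℝ, 0 < A ∧ A < Real.pi ∧
        ∀ t ∈ Set.Ioc (x₀ - A) (x₀ + A), t ∈ Set.Ioo 0 Real.pi ∧ sidePoint i c t ∈ Γ := by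
  obtain ⟨⟨U, hU, rfl⟩, ⟨p, hp⟩, i, c, hc, hside⟩ := hΓ
  have hsub : U ∩ frontier square ⊆ sidePoint i c '' Set.Icc 0 Real.pi := by
    intro x hx
    obtain ⟨-, hxc⟩ := hside (subset_closure hx)
    exact ⟨x (i + 1), (mem_frontier_square.mp hx.2).1 _, (eq_sidePoint hxc).symm⟩
  refine ⟨i, c, hc, hsub, ?_⟩
  obtain ⟨t₀, ht₀, rfl⟩ := hsub hp
  have hpi := Real.pi_pos
  obtain ⟨η, hη, hball⟩ := Metric.isOpen_iff.mp
    (hU.preimage (isometry_sidePoint i c).continuous) t₀ hp.1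
  -- the interval `(t₀ - η, t₀ + η)` need not lie in `(0, π)`: take a part of it on the side
  -- of `π / 2`
  set A := min η Real.pi / 8 with hA
  have hA0 : 0 < A := by positivity
  have hAη : 8 * A ≤ η := by have := min_le_left η Real.pi; linarith
  have hAπ : 8 * A ≤ Real.pi := by have := min_le_right η Real.pi; linarith
  have key : ∀ x₀ : ℝ, |x₀ - t₀| ≤ 2 * A → A < x₀ → x₀ + A < Real.pi →
      ∀ t ∈ Set.Ioc (x₀ - A) (x₀ + A),
        t ∈ Set.Ioo 0 Real.pi ∧ sidePoint i c t ∈ U ∩ frontier square := by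
    intro x₀ h1 h2 h3 t ht
    have htI : t ∈ Set.Ioo 0 Real.pi := ⟨by linarith [ht.1], by linarith [ht.2]⟩
    refine ⟨htI, hball ?_, mem_frontier_square.mpr ⟨fun j => ?_, fun h => ?_⟩⟩
    · rw [Metric.mem_ball, Real.dist_eq, abs_lt]
      have := abs_le.mp h1
      constructor <;> linarith [ht.1, ht.2]
    · by_cases h : j = i
      · rw [h, sidePoint_self]
        rcases hc with rfl | rfl
        · exact ⟨le_rfl, hpi.le⟩
        · exact ⟨hpi.le, le_rfl⟩
      · rw [sidePoint_of_ne h]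
        exact ⟨htI.1.le, htI.2.le⟩
    · have := h i
      rw [sidePoint_self] at this
      rcases hc with rfl | rfl
      · exact lt_irrefl _ this.1
      · exact lt_irrefl _ this.2
  rcases le_total t₀ (Real.pi / 2) with h | h
  · refine ⟨t₀ + 2 * A, A, hA0, by linarith, key _ ?_ ?_ ?_⟩
    · rw [add_sub_cancel_left, abs_of_pos (by linarith)]
    · linarith [ht₀.1]
    · linarith
  · refine ⟨t₀ - 2 * A, A, hA0, by linarith, key _ ?_ ?_ ?_⟩
    · rw [sub_sub_cancel_left, abs_neg, abs_of_pos (by linarith)]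
    · linarith
    · linarith [ht₀.2]

/-- Arc length on a side is Lebesgue measure. -/
theorem normSqObservation_eq {Γ : Set Plane} {i : Fin 2} {c : ℝ}
    (hsub : Γ ⊆ sidePoint i c '' Set.Icc 0 Real.pi) (u : Plane → ℂ) :
    normSqObservation Γ u =
      ∫ t in sidePoint i c ⁻¹' Γ, ‖normalDerivative u (sidePoint i c t)‖ ^ 2 := by
  have hiso := isometry_sidePoint i c
  have hemb : MeasurableEmbedding (sidePoint i c) := hiso.isClosedEmbedding.measurableEmbedding
  rw [normSqObservation, ← hausdorffMeasure_real,
    ← hemb.setIntegral_map fun x => ‖normalDerivative u x‖ ^ 2,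
    hiso.map_hausdorffMeasure (Or.inl zero_le_one), Measure.restrict_restrict_of_subset]
  exact hsub.trans (Set.image_subset_range _ _)

/-- Besides positivity of the integrand this uses its integrability on all of `Γ`; the two corners,
where the normal derivative is not the partial derivative, form a null set. -/
theorem integral_le_normSqObservation {Γ : Set Plane} {i : Fin 2} {c x₀ A : ℝ}
    (hc : c = 0 ∨ c = Real.pi) (hsub : Γ ⊆ sidePoint i c '' Set.Icc 0 Real.pi) (hA : 0 < A)
    (hI : ∀ t ∈ Set.Ioc (x₀ - A) (x₀ + A), t ∈ Set.Ioo 0 Real.pi ∧ sidePoint i c t ∈ Γ)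
    (Q : Finset (ℕ+ × ℕ+)) (a : ℕ+ × ℕ+ → ℂ) :
    ∫ t in (x₀ - A)..(x₀ + A), ‖partialCombination Q a i c t‖ ^ 2 ≤
      normSqObservation Γ (combination Q a) := by
  have hcont : Continuous fun t => ‖partialCombination Q a i c t‖ ^ 2 :=
    (((continuous_partialCombination Q a i).comp
      (continuous_const.prodMk continuous_id)).norm.pow 2 :)
  have hpre : sidePoint i c ⁻¹' Γ ⊆ Set.Icc 0 Real.pi := by
    intro t ht
    obtain ⟨s, hs, hst⟩ := hsub ht
    rwa [← (isometry_sidePoint i c).injective hst]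
  have hae : (fun t => ‖partialCombination Q a i c t‖ ^ 2)
      =ᵐ[volume.restrict (Set.Icc 0 Real.pi)]
      fun t => ‖normalDerivative (combination Q a) (sidePoint i c t)‖ ^ 2 := by
    rw [← restrict_Ioo_eq_restrict_Icc]
    filter_upwards [ae_restrict_mem measurableSet_Ioo] with t ht
    rw [norm_normalDerivative_combination Q a hc ht]
  have hint : IntegrableOn
      (fun t => ‖normalDerivative (combination Q a) (sidePoint i c t)‖ ^ 2)
      (sidePoint i c ⁻¹' Γ) :=
    IntegrableOn.mono_set (hcont.integrableOn_Icc.congr hae) hpre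
  rw [normSqObservation_eq hsub, intervalIntegral.integral_of_le (by linarith)]
  calc ∫ t in Set.Ioc (x₀ - A) (x₀ + A), ‖partialCombination Q a i c t‖ ^ 2
      = ∫ t in Set.Ioc (x₀ - A) (x₀ + A),
          ‖normalDerivative (combination Q a) (sidePoint i c t)‖ ^ 2 :=
        setIntegral_congr_fun measurableSet_Ioc fun t ht => by
          simp only [norm_normalDerivative_combination Q a hc (hI t ht).1]
    _ ≤ _ := setIntegral_mono_set hint (Filter.Eventually.of_forall fun t => sq_nonneg _)
        (Filter.Eventually.of_forall fun t ht => (hI t ht).2)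

/-! ### The energy -/

/-- The coordinates of the plane, as a volume preserving equivalence. -/
def planeEquivProd : Plane ≃ᵐ ℝ × ℝ :=
  (MeasurableEquiv.toLp 2 (Fin 2 → ℝ)).symm.trans (MeasurableEquiv.piFinTwo fun _ => ℝ)

theorem measurePreserving_planeEquivProd : MeasurePreserving planeEquivProd volume volume :=
  (volume_preserving_piFinTwo fun _ => ℝ).comp
    (EuclideanSpace.volume_preserving_symm_measurableEquiv_toLp (Fin 2))

/-- In an eigenspace, each of the two frequencies determines the index. -/
theorem injOn_frequency {Q : Finset (ℕ+ × ℕ+)} {N : ℕ}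
    (hQ : ∀ k ∈ Q, (k.1 : ℕ) ^ 2 + (k.2 : ℕ) ^ 2 = N) (i : Fin 2) :
    Set.InjOn (fun k => frequency k i) Q := by
  have h : ∀ k ∈ Q, ∀ l ∈ Q, (k.1 = l.1 ∨ k.2 = l.2) → k = l := by
    rintro ⟨k1, k2⟩ hk ⟨l1, l2⟩ hl h
    have h1 := hQ _ hk
    have h2 := hQ _ hl
    simp only at h h1 h2
    rcases h with rfl | rfl
    · have : (k2 : ℕ) ^ 2 = (l2 : ℕ) ^ 2 := by omega
      rw [PNat.coe_injective (Nat.pow_left_injective two_ne_zero this)]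
    · have : (k1 : ℕ) ^ 2 = (l1 : ℕ) ^ 2 := by omega
      rw [PNat.coe_injective (Nat.pow_left_injective two_ne_zero this)]
  intro k hk l hl hkl
  revert i
  rw [Fin.forall_fin_two]
  constructor
  · intro hkl
    exact h k hk l hl (Or.inr (by simpa [frequency] using hkl))
  · intro hkl
    exact h k hk l hl (Or.inl (by simpa [frequency] using hkl))

theorem eigenvalue_eq {Q : Finset (ℕ+ × ℕ+)} {N : ℕ}
    (hQ : ∀ k ∈ Q, (k.1 : ℕ) ^ 2 + (k.2 : ℕ) ^ 2 = N) {k : ℕ+ × ℕ+} (hk : k ∈ Q) :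
    eigenvalue k = N := by
  rw [eigenvalue, ← hQ k hk]
  push_cast
  rfl

/-- Upper bound of the energy by the coefficients. The eigenfunctions are orthonormal in `X`; using
only orthogonality in the second variable, over `(-π, π)`, and bounding the squared sines and cosines
of the first variable by `1` costs the factor `4`. -/
theorem normSqX_combination_le {Q : Finset (ℕ+ × ℕ+)} {N : ℕ}
    (hQ : ∀ k ∈ Q, (k.1 : ℕ) ^ 2 + (k.2 : ℕ) ^ 2 = N) (a : ℕ+ × ℕ+ → ℂ) :
    normSqX (combination Q a) ≤ 4 * ∑ k ∈ Q, ‖a k‖ ^ 2 := by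
  set Φ : ℝ × ℝ → ℝ := fun p =>
    ‖partialCombination Q a 0 p.1 p.2‖ ^ 2 + ‖partialCombination Q a 1 p.2 p.1‖ ^ 2 with hΦ
  have hc0 := continuous_partialCombination Q a 0
  have hc1 : Continuous fun p : ℝ × ℝ => partialCombination Q a 1 p.2 p.1 :=
    ((continuous_partialCombination Q a 1).comp continuous_swap :)
  have hΦc : Continuous Φ := (hc0.norm.pow 2).add (hc1.norm.pow 2)
  have hsq : square = planeEquivProd ⁻¹' (Set.Ioo 0 Real.pi ×ˢ Set.Ioo 0 Real.pi) := by
    ext x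
    simp only [square, Set.mem_ofPred_eq, Fin.forall_fin_two, Set.mem_preimage, Set.mem_prod]
    rfl
  have h1 : normSqX (combination Q a) =
      ∫ p in Set.Ioo 0 Real.pi ×ˢ Set.Ioo 0 Real.pi, Φ p ∂(volume.prod volume) := by
    have h2 : ∀ x : Plane, ∑ i : Fin 2, ‖fderiv ℝ (combination Q a) x
        (EuclideanSpace.single i 1)‖ ^ 2 = Φ (planeEquivProd x) := by
      intro x
      simp_rw [fderiv_combination, Fin.sum_univ_two]
      rfl
    rw [normSqX, hsq]
    simp_rw [h2]
    exact measurePreserving_planeEquivProd.setIntegral_preimage_emb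
      planeEquivProd.measurableEmbedding Φ _
  have hint : IntegrableOn Φ (Set.Ioo 0 Real.pi ×ˢ Set.Ioo 0 Real.pi) (volume.prod volume) :=
    (hΦc.integrableOn_Icc (a := ((0 : ℝ), (0 : ℝ))) (b := (Real.pi, Real.pi))).mono_set (by
      rw [← Set.Icc_prod_Icc]
      exact Set.prod_mono Set.Ioo_subset_Icc_self Set.Ioo_subset_Icc_self)
  rw [h1, setIntegral_prod _ hint]
  have hpi := Real.pi_pos
  have hinner : ∀ s : ℝ, ∫ t in Set.Ioo 0 Real.pi, Φ (s, t) ≤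
      4 / Real.pi * ∑ k ∈ Q, ‖a k‖ ^ 2 := by
    intro s
    have e0 : ∀ t, partialCombination Q a 0 s t = ∑ k ∈ Q,
        (a k * ((amplitude k * (k.2 : ℕ) * Real.cos ((k.2 : ℕ) * s) : ℝ) : ℂ)) *
          (Real.sin ((k.1 : ℕ) * t) : ℂ) := by
      intro t
      refine Finset.sum_congr rfl fun k _ => ?_
      simp [frequency]
      ring
    have e1 : ∀ t, partialCombination Q a 1 t s = ∑ k ∈ Q,
        (a k * ((amplitude k * (k.1 : ℕ) * Real.sin ((k.2 : ℕ) * s) : ℝ) : ℂ)) *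
          (Real.cos ((k.1 : ℕ) * t) : ℂ) := by
      intro t
      refine Finset.sum_congr rfl fun k _ => ?_
      simp [frequency]
      ring
    have hm : Set.InjOn (fun k : ℕ+ × ℕ+ => k.1) Q := injOn_frequency hQ 1
    have b0 := setIntegral_norm_sq_sum_sin_le hm
      fun k => a k * ((amplitude k * (k.2 : ℕ) * Real.cos ((k.2 : ℕ) * s) : ℝ) : ℂ)
    have b1 := setIntegral_norm_sq_sum_cos_le hm
      fun k => a k * ((amplitude k * (k.1 : ℕ) * Real.sin ((k.2 : ℕ) * s) : ℝ) : ℂ)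
    have i0 : IntegrableOn (fun t => ‖partialCombination Q a 0 s t‖ ^ 2) (Set.Ioo 0 Real.pi) :=
      ((((hc0.comp (continuous_const.prodMk continuous_id)).norm.pow 2 :)) : Continuous _)
        |>.integrableOn_Icc.mono_set Set.Ioo_subset_Icc_self
    have i1 : IntegrableOn (fun t => ‖partialCombination Q a 1 t s‖ ^ 2) (Set.Ioo 0 Real.pi) :=
      ((((hc1.comp (continuous_const.prodMk continuous_id)).norm.pow 2 :)) : Continuous _)
        |>.integrableOn_Icc.mono_set Set.Ioo_subset_Icc_self
    rw [hΦ, integral_add i0 i1]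
    simp_rw [e0, e1]
    refine (add_le_add b0 b1).trans ?_
    rw [← mul_add, ← Finset.sum_add_distrib, Finset.mul_sum, Finset.mul_sum]
    refine Finset.sum_le_sum fun k hk => ?_
    rw [norm_mul, norm_mul, Complex.norm_real, Complex.norm_real, mul_pow, mul_pow,
      Real.norm_eq_abs, Real.norm_eq_abs, sq_abs, sq_abs, mul_pow, mul_pow, mul_pow, mul_pow,
      amplitude_sq]
    have hN : eigenvalue k = (k.1 : ℕ) ^ 2 + (k.2 : ℕ) ^ 2 := rfl
    have hpos := eigenvalue_pos k
    have hcos := Real.cos_sq_le_one ((k.2 : ℕ) * s)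
    have hsin := Real.sin_sq_le_one ((k.2 : ℕ) * s)
    calc Real.pi * (‖a k‖ ^ 2 * (4 / (Real.pi ^ 2 * eigenvalue k) * ((k.2 : ℕ) : ℝ) ^ 2 *
            Real.cos ((k.2 : ℕ) * s) ^ 2) +
          ‖a k‖ ^ 2 * (4 / (Real.pi ^ 2 * eigenvalue k) * ((k.1 : ℕ) : ℝ) ^ 2 *
            Real.sin ((k.2 : ℕ) * s) ^ 2))
        ≤ Real.pi * (‖a k‖ ^ 2 * (4 / (Real.pi ^ 2 * eigenvalue k) * ((k.2 : ℕ) : ℝ) ^ 2 * 1) +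
          ‖a k‖ ^ 2 * (4 / (Real.pi ^ 2 * eigenvalue k) * ((k.1 : ℕ) : ℝ) ^ 2 * 1)) := by
          gcongr
      _ = 4 / Real.pi * ‖a k‖ ^ 2 *
            ((((k.1 : ℕ) : ℝ) ^ 2 + ((k.2 : ℕ) : ℝ) ^ 2) / eigenvalue k) := by
          field_simp
          ring
      _ = 4 / Real.pi * ‖a k‖ ^ 2 := by
          rw [← hN, div_self hpos.ne', mul_one]
  have hΦ0 : ∀ p, 0 ≤ Φ p := fun p => by positivity
  have hbound := norm_setIntegral_le_of_norm_le_const (μ := volume) (s := Set.Ioo 0 Real.pi)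
    (f := fun s => ∫ t in Set.Ioo 0 Real.pi, Φ (s, t))
    (C := 4 / Real.pi * ∑ k ∈ Q, ‖a k‖ ^ 2) (by simp) (fun s _ => by
      rw [Real.norm_eq_abs, abs_of_nonneg (integral_nonneg fun t => hΦ0 _)]
      exact hinner s)
  refine (le_abs_self _).trans (hbound.trans (le_of_eq ?_))
  rw [Measure.real, Real.volume_Ioo, sub_zero, ENNReal.toReal_ofReal hpi.le]
  field_simp

/-! ### Observability -/

/-- The observability of the eigenspaces, with a constant that depends on `Γ` only. -/
theorem IsOneSidedObservationSet.exists_observability {Γ : Set Plane}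
    (hΓ : IsOneSidedObservationSet Γ) : ∃ δ : ℝ, 0 < δ ∧
      ∀ (N : ℕ) (Q : Finset (ℕ+ × ℕ+)), (∀ k ∈ Q, (k.1 : ℕ) ^ 2 + (k.2 : ℕ) ^ 2 = N) →
        ∀ a : ℕ+ × ℕ+ → ℂ,
          δ / N * normSqX (combination Q a) ≤ normSqObservation Γ (combination Q a) := by
  obtain ⟨i, c, hc, hsub, x₀, A, hA0, hA, hI⟩ := hΓ.exists_interval
  obtain ⟨K, hK, hobs⟩ := exists_sum_sq_le_integral_sin hA0 hA
  have hpi := Real.pi_pos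
  refine ⟨1 / (K * Real.pi ^ 2), by positivity, fun N Q hQ a => ?_⟩
  refine le_trans ?_ (integral_le_normSqObservation hc hsub hA0 hI Q a)
  set b : ℕ+ × ℕ+ → ℂ := fun k =>
    a k * ((amplitude k * ((frequency k i : ℕ) * Real.cos ((frequency k i : ℕ) * c)) : ℝ) : ℂ)
    with hb
  have h1 := hobs Q (fun k => frequency k (i + 1)) (fun k => frequency k i) N
    (injOn_frequency hQ (i + 1)) (by
      intro k hk
      rw [← hQ k hk]
      push_cast
      revert i
      rw [Fin.forall_fin_two]
      constructor
      · simp [frequency]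
      · simp [frequency, add_comm]) b x₀
  have h2 : ∀ t, ∑ k ∈ Q, b k * (Real.sin ((frequency k (i + 1) : ℕ) * t) : ℂ) =
      partialCombination Q a i c t := by
    intro t
    refine Finset.sum_congr rfl fun k _ => ?_
    rw [hb]
    push_cast
    ring
  simp_rw [h2] at h1
  have hcos : ∀ m : ℕ, Real.cos (m * c) ^ 2 = 1 := by
    intro m
    rcases hc with rfl | rfl
    · simp
    · rw [Real.cos_nat_mul_pi, ← pow_mul, mul_comm, pow_mul]; simp
  have h3 : 4 / (Real.pi ^ 2 * N) * ∑ k ∈ Q, ‖a k‖ ^ 2 ≤ ∑ k ∈ Q, ‖b k‖ ^ 2 := by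
    rw [Finset.mul_sum]
    refine Finset.sum_le_sum fun k hk => ?_
    have hf : (1 : ℝ) ≤ (frequency k i : ℕ) := by exact_mod_cast (frequency k i).pos
    have hN := eigenvalue_eq hQ hk
    have hpos := eigenvalue_pos k
    rw [hb, norm_mul, Complex.norm_real, mul_pow, Real.norm_eq_abs, sq_abs, mul_pow, mul_pow,
      hcos, mul_one, amplitude_sq, ← hN, mul_comm]
    have : (1 : ℝ) ≤ ((frequency k i : ℕ) : ℝ) ^ 2 := one_le_pow₀ hf
    gcongr
    exact le_mul_of_one_le_right (by positivity) this
  have h4 := normSqX_combination_le hQ a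
  have h5 := h3.trans h1
  calc 1 / (K * Real.pi ^ 2) / N * normSqX (combination Q a)
      ≤ 1 / (K * Real.pi ^ 2) / N * (4 * ∑ k ∈ Q, ‖a k‖ ^ 2) := by gcongr
    _ = 1 / K * (4 / (Real.pi ^ 2 * N) * ∑ k ∈ Q, ‖a k‖ ^ 2) := by
        simp only [div_eq_mul_inv, mul_inv]
        ring
    _ ≤ 1 / K * (K * ∫ t in (x₀ - A)..(x₀ + A), ‖partialCombination Q a i c t‖ ^ 2) := by
        gcongr
    _ = _ := by field_simp

theorem eigenvalue_eq_natCast (k : ℕ+ × ℕ+) :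
    eigenvalue k = (((k.1 : ℕ) ^ 2 + (k.2 : ℕ) ^ 2 : ℕ) : ℝ) := by
  rw [eigenvalue]
  push_cast
  rfl

/-- The eigenvalues being integers, an open interval of length one contains at most one of them. -/
theorem sq_add_sq_eq_of_mem_indexSet {μ : ℝ} {k l : ℕ+ × ℕ+} (hk : k ∈ indexSet (1 / 2) μ)
    (hl : l ∈ indexSet (1 / 2) μ) :
    (k.1 : ℕ) ^ 2 + (k.2 : ℕ) ^ 2 = (l.1 : ℕ) ^ 2 + (l.2 : ℕ) ^ 2 := by
  have h1 := abs_lt.mp (show |μ - eigenvalue k| < 1 / 2 from hk)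
  have h2 := abs_lt.mp (show |μ - eigenvalue l| < 1 / 2 from hl)
  rw [eigenvalue_eq_natCast] at h1 h2
  generalize (k.1 : ℕ) ^ 2 + (k.2 : ℕ) ^ 2 = p at *
  generalize (l.1 : ℕ) ^ 2 + (l.2 : ℕ) ^ 2 = q at *
  have h3 : (p : ℝ) < q + 1 := by linarith [h1.1, h1.2, h2.1, h2.2]
  have h4 : (q : ℝ) < p + 1 := by linarith [h1.1, h1.2, h2.1, h2.2]
  have h3' : p < q + 1 := by exact_mod_cast h3
  have h4' : q < p + 1 := by exact_mod_cast h4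
  omega

end SquareObservability

theorem lemma5p4 (Γ : Set SquareObservability.Plane)
    (hΓ : SquareObservability.IsOneSidedObservationSet Γ) :
    SquareObservability.IsWeaklySpectrallyCoercive Γ ∧
    ∃ δ : ℝ, 0 < δ ∧ ∀ (m n : ℕ+) (a : ℕ+ × ℕ+ → ℂ),
      δ / SquareObservability.eigenvalue (m, n) *
          SquareObservability.normSqX
            (SquareObservability.spectralSum (1 / 2) (SquareObservability.eigenvalue (m, n)) a) ≤
        SquareObservability.normSqObservation Γ
          (SquareObservability.spectralSum (1 / 2) (SquareObservability.eigenvalue (m, n)) a) := by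
  open SquareObservability in
  obtain ⟨δ, hδ, h⟩ := hΓ.exists_observability
  have hspec : ∀ (μ : ℝ) (a : ℕ+ × ℕ+ → ℂ) (k : ℕ+ × ℕ+), k ∈ indexSet (1 / 2) μ →
      δ / eigenvalue k * normSqX (spectralSum (1 / 2) μ a) ≤
        normSqObservation Γ (spectralSum (1 / 2) μ a) := by
    intro μ a k hk
    rw [eigenvalue_eq_natCast]
    exact h _ (indexSet_finite (1 / 2) μ).toFinset (fun l hl =>
      sq_add_sq_eq_of_mem_indexSet ((indexSet_finite (1 / 2) μ).mem_toFinset.mp hl) hk) a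
  refine ⟨⟨1 / 2, by norm_num, fun t => δ / (t + 1), ⟨?_, ?_, ?_⟩, fun μ hμ a => ?_⟩,
    δ, hδ, fun m n a => hspec _ a (m, n) ?_⟩
  · refine continuousOn_const.div (by fun_prop) fun t ht => ?_
    have : (0 : ℝ) ≤ t := ht
    positivity
  · intro s hs t ht hst
    have : (0 : ℝ) ≤ s := hs
    simp only
    gcongr
  · intro t ht
    positivity
  · have hX : 0 ≤ normSqX (spectralSum (1 / 2) μ a) :=
      integral_nonneg fun x => Finset.sum_nonneg fun i _ => sq_nonneg _
    rcases (indexSet (1 / 2) μ).eq_empty_or_nonempty with he | ⟨k, hk⟩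
    · have h0 : spectralSum (1 / 2) μ a = fun _ => 0 := by
        ext x
        refine Finset.sum_eq_zero fun k hk => ?_
        have hk' := (indexSet_finite (1 / 2) μ).mem_toFinset.mp hk
        rw [he] at hk'
        exact absurd hk' (Set.notMem_empty k)
      have h1 : normSqX (spectralSum (1 / 2) μ a) = 0 := by
        rw [h0]
        simp [normSqX]
      rw [h1, mul_zero]
      exact integral_nonneg fun x => sq_nonneg _
    · refine le_trans ?_ (hspec μ a k hk)
      have h1 := abs_lt.mp (show |μ - eigenvalue k| < 1 / 2 from hk)
      have h2 := eigenvalue_pos k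
      refine mul_le_mul_of_nonneg_right ?_ hX
      exact div_le_div_of_nonneg_left hδ.le h2 (by linarith [h1.1])
  · change |_ - _| < (1 / 2 : ℝ)
    rw [sub_self, abs_zero]
    norm_num
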